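/- Conventions. A Weil algebra is a finite-dimensional commutative $\mathbf{R}$-algebra $W$ with an augmentation $W\to\mathbf{R}$ whose kernel is nilpotent; a cahiers algebra is an $\mathbf{R}$-algebra isomorphic to $\mathbf{R}[X_1,\dots,X_n]\otimes W$ with $n\ge 0$ and $W$ a Weil algebra. Let $\mathfrak{W}\subset\widetilde{\mathfrak{W}}$ be the categories of Weil algebras and of cahiers algebras, with all $\mathbf{R}$-algebra homomorphisms. A Weil category is a pair $(\mathcal{K},\mathbf{D})$ of an (elementary) topos $\mathcal{K}$ and a functor $\mathbf{D}:\widetilde{\mathfrak{W}}^{\mathrm{op}}\to\mathcal{K}$ preserving finite products; thus $\mathbf{D}(\mathbf{R})=1$ and $\mathbf{D}(A\otimes B)=\mathbf{D}(A)\times\mathbf{D}(B)$. Put $\mathbb{R}=\mathbf{D}(\mathbf{R}[X])$, $D=\mathbf{D}(\mathbf{R}[X]/(X^2))$ and $D(2)=\mathbf{D}(\mathbf{R}[X,Y]/(X^2,Y^2,XY))$. The maps $X\mapsto X+Y$ and $X\mapsto XY$ from $\mathbf{R}[X]$ to $\mathbf{R}[X,Y]$, and $X\mapsto 1$ from $\mathbf{R}[X]$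 to $\mathbf{R}$, induce via $\mathbf{D}$ the addition, the multiplication and the unity of $\mathbb{R}$. The map $\mathbf{R}[X]/(X^2)\to\mathbf{R}[X,Y]/(X^2)$, $X\mapsto XY$, induces an action $D\times\mathbb{R}\to D$. An object $M$ of $\mathcal{K}$ is microlinear if, for every finite diagram of Weil algebras and every cone over it whose vertex is a Weil algebra and which is a limit cone of commutative $\mathbf{R}$-algebras, the functor $W\mapsto M^{\mathbf{D}(W)}$ sends this cone to a limit cone in $\mathcal{K}$. Theorem 5.1. Let $(\mathcal{K},\mathbf{D})$ be a Weil category and let $M$ be a microlinear object of $\mathcal{K}$. Let $\pi:M^D\to M^{\mathbf{D}(\mathbf{R})}=M$ be induced by $\mathbf{R}[X]/(X^2)\to\mathbf{R}$, $X\mapsto 0$ (evaluation at $0\in D$). (1) The square formed by the maps $p_1,p_2:\mathbf{R}[X,Y]/(X^2,Y^2,XY)\to\mathbf{R}[X]/(X^2)$, $p_1:(X,Y)\mapsto(X,0)$, $p_2:(X,Y)\mapsto(0,X)$, and (twice) the map $\mathbf{R}[X]/(X^2)\to\mathbf{R}$, $X\mapsto 0$, is a pullback, both in $\mathfrak{W}$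 and in commutative $\mathbf{R}$-algebras. The induced square with corners $M^{D(2)},M^D,M^D,M^{\mathbf{D}(\mathbf{R})}$ is a pullback in $\mathcal{K}$; evaluation at the point of $\mathbf{D}(\mathbf{R})=1$ is an isomorphism $M^{\mathbf{D}(\mathbf{R})}\cong M$; hence $(M^{\mathbf{D}(p_1)},M^{\mathbf{D}(p_2)}):M^{D(2)}\to M^D\times_M M^D$ is an isomorphism. (2) In the slice category $\mathcal{K}/M$, the projection $\mathbb{R}\times M\to M$ is a commutative ring object with the addition, multiplication and unity coming fiberwise from those of $\mathbb{R}$, and $\pi:M^D\to M$ is a (unital) module object over this ring object, with respect to - the addition $\varphi:M^D\times_M M^D\cong M^{D(2)}\to M^D$ given by $M^{\mathbf{D}(f)}$ with $f:\mathbf{R}[X,Y]/(X^2,Y^2,XY)\to\mathbf{R}[X]/(X^2)$, $(X,Y)\mapsto(X,X)$; - the scalar multiplication $(\mathbb{R}\times M)\times_M M^D=\mathbb{R}\times M^D\xrightarrow{\psi_1}M^D$, where $\psi_1$ is the transpose of the composite $D\times\mathbb{R}\times M^D\to D\times M^D\to M$ of the action of $\mathbb{R}$ on $D$ (times $M^D$)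 and the evaluation. -/

import Mathlib

open CategoryTheory Limits MonoidalCategory CartesianMonoidalCategory Opposite
open scoped TensorProduct

universe v u

noncomputable section

namespace WeilCat

/-! ### Weil algebras and cahiers algebras -/

/-- A commutative `ℝ`-algebra is a Weil algebra when it is finite dimensional and is the direct sum
of `ℝ` and a nilpotent ideal, the latter being the kernel of an augmentation `W →ₐ[ℝ] ℝ`. -/
def IsWeilAlg : ObjectProperty (CommAlgCat.{0} ℝ) := fun W =>
  Module.Finite ℝ W ∧ ∃ e : W →ₐ[ℝ] ℝ, IsNilpotent (RingHom.ker e)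

/-- A cahiers algebra is an algebra isomorphic to `ℝ[X₁, …, Xₙ] ⊗ W` with `W` a Weil algebra. -/
def IsCahiersAlg : ObjectProperty (CommAlgCat.{0} ℝ) := fun A =>
  ∃ (n : ℕ) (W : CommAlgCat.{0} ℝ), IsWeilAlg W ∧
    Nonempty (A ≃ₐ[ℝ] MvPolynomial (Fin n) ℝ ⊗[ℝ] W)

/-- The category of Weil algebras and `ℝ`-algebra homomorphisms. -/
abbrev WeilAlg := IsWeilAlg.FullSubcategory

/-- The category of cahiers algebras and `ℝ`-algebra homomorphisms. -/
abbrev CahiersAlg := IsCahiersAlg.FullSubcategory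

theorem isWeilAlg_of (A : Type) [CommRing A] [Algebra ℝ A] [Module.Finite ℝ A] (e : A →ₐ[ℝ] ℝ)
    (h : ∀ x, IsNilpotent (x - algebraMap ℝ A (e x))) : IsWeilAlg (.of ℝ A) := by
  refine ⟨‹_›, e, ?_⟩
  have : IsNoetherianRing A := IsNoetherianRing.of_finite ℝ A
  rw [Ideal.FG.isNilpotent_iff_le_nilradical (IsNoetherian.noetherian _)]
  intro x hx
  have h0 : e x = 0 := hx
  have := h x
  rwa [h0, map_zero, sub_zero] at this

theorem isNilpotent_sub {W : Type} [CommRing W] [Algebra ℝ W] {e : W →ₐ[ℝ] ℝ}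
    (he : IsNilpotent (RingHom.ker e)) (x : W) : IsNilpotent (x - algebraMap ℝ W (e x)) := by
  obtain ⟨n, hn⟩ := he
  refine ⟨n, ?_⟩
  have : x - algebraMap ℝ W (e x) ∈ RingHom.ker e := by simp [RingHom.mem_ker]
  have := Ideal.pow_mem_pow this n
  rw [hn] at this
  simpa using this

theorem isWeilAlg_real : IsWeilAlg (.of ℝ ℝ) :=
  isWeilAlg_of ℝ (AlgHom.id ℝ ℝ) (by simp)

theorem isWeilAlg_tensor {V W : CommAlgCat.{0} ℝ} (hV : IsWeilAlg V) (hW : IsWeilAlg W) :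
    IsWeilAlg (.of ℝ (V ⊗[ℝ] W)) := by
  obtain ⟨_, e, he⟩ := hV
  obtain ⟨_, e', he'⟩ := hW
  refine isWeilAlg_of _ (Algebra.TensorProduct.lift e e' fun _ _ => .all _ _) fun x => ?_
  induction x with
  | zero => simp
  | add x y hx hy =>
    rw [map_add, map_add, add_sub_add_comm]
    exact (Commute.all _ _).isNilpotent_add hx hy
  | tmul a b =>
    have h1 := (isNilpotent_sub he a).map (Algebra.TensorProduct.includeLeft : V →ₐ[ℝ] V ⊗[ℝ] W)
    have h2 := (isNilpotent_sub he' b).map (Algebra.TensorProduct.includeRight : W →ₐ[ℝ] V ⊗[ℝ] W)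
    have key : a ⊗ₜ[ℝ] b - algebraMap ℝ (V ⊗[ℝ] W) (e a * e' b) =
        ((a - algebraMap ℝ V (e a)) ⊗ₜ[ℝ] (1 : W)) * ((1 : V) ⊗ₜ[ℝ] b) +
        ((1 : V) ⊗ₜ[ℝ] (b - algebraMap ℝ W (e' b))) * algebraMap ℝ (V ⊗[ℝ] W) (e a) := by
      simp only [TensorProduct.sub_tmul, TensorProduct.tmul_sub, Algebra.algebraMap_eq_smul_one,
        TensorProduct.smul_tmul, TensorProduct.tmul_smul, sub_mul, mul_smul_comm, smul_mul_assoc,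
        Algebra.TensorProduct.tmul_mul_tmul, one_mul, mul_one, ← Algebra.TensorProduct.one_def,
        mul_smul]
      module
    rw [Algebra.TensorProduct.lift_tmul, key]
    exact (Commute.all _ _).isNilpotent_add ((Commute.all _ _).isNilpotent_mul_right h1)
      ((Commute.all _ _).isNilpotent_mul_right h2)

theorem isWeilAlg_le_isCahiersAlg : IsWeilAlg ≤ IsCahiersAlg := fun W hW =>
  ⟨0, W, hW, ⟨((Algebra.TensorProduct.congr (MvPolynomial.isEmptyAlgEquiv ℝ (Fin 0))
    AlgEquiv.refl).trans (Algebra.TensorProduct.lid ℝ W)).symm⟩⟩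

theorem isCahiersAlg_polynomial : IsCahiersAlg (.of ℝ (Polynomial ℝ)) :=
  ⟨1, .of ℝ ℝ, isWeilAlg_real, ⟨(MvPolynomial.uniqueAlgEquiv ℝ (Fin 1)).symm.trans
    (Algebra.TensorProduct.rid ℝ ℝ _).symm⟩⟩

theorem isCahiersAlg_tensor {A B : CommAlgCat.{0} ℝ} (hA : IsCahiersAlg A) (hB : IsCahiersAlg B) :
    IsCahiersAlg (.of ℝ (A ⊗[ℝ] B)) := by
  obtain ⟨n, V, hV, ⟨e⟩⟩ := hA
  obtain ⟨m, W, hW, ⟨f⟩⟩ := hB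
  exact ⟨n + m, _, isWeilAlg_tensor hV hW, ⟨(Algebra.TensorProduct.congr e f).trans
    ((Algebra.TensorProduct.tensorTensorTensorComm ℝ ℝ ℝ ℝ _ _ _ _).trans
      (Algebra.TensorProduct.congr ((MvPolynomial.tensorEquivSum ℝ (Fin n) (Fin m) ℝ).trans
        (MvPolynomial.renameEquiv ℝ finSumFinEquiv)) AlgEquiv.refl))⟩⟩

/-- The inclusion of Weil algebras into cahiers algebras. -/
abbrev weilToCahiers : WeilAlg ⥤ CahiersAlg := ObjectProperty.ιOfLE isWeilAlg_le_isCahiersAlg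

/-- The tensor product of cahiers algebras. -/
abbrev CahiersAlg.tensor (A B : CahiersAlg) : CahiersAlg :=
  ⟨.of ℝ (A.obj ⊗[ℝ] B.obj), isCahiersAlg_tensor A.property B.property⟩

/-- `a ↦ a ⊗ 1`. -/
def CahiersAlg.inl (A B : CahiersAlg) : A ⟶ A.tensor B :=
  ObjectProperty.homMk (CommAlgCat.ofHom Algebra.TensorProduct.includeLeft)

/-- `b ↦ 1 ⊗ b`. -/
def CahiersAlg.inr (A B : CahiersAlg) : B ⟶ A.tensor B :=
  ObjectProperty.homMk (CommAlgCat.ofHom Algebra.TensorProduct.includeRight)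

/-- The tensor product is the coproduct of cahiers algebras. -/
def CahiersAlg.isColimit (A B : CahiersAlg) : IsColimit (BinaryCofan.mk (A.inl B) (A.inr B)) :=
  BinaryCofan.IsColimit.mk _
    (fun f g => ObjectProperty.homMk (CommAlgCat.ofHom
      (Algebra.TensorProduct.lift f.hom.hom g.hom.hom fun _ _ => .all _ _)))
    (fun f g => by
      ext1; ext1; exact Algebra.TensorProduct.lift_comp_includeLeft _ _ fun _ _ => .all _ _)
    (fun f g => by
      ext1; ext1; exact Algebra.TensorProduct.lift_comp_includeRight _ _ fun _ _ => .all _ _)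
    (fun f g m h₁ h₂ => by
      ext1; ext1
      refine Algebra.TensorProduct.ext ?_ ?_
      · exact (congrArg (fun k => k.hom.hom) h₁).trans
          (Algebra.TensorProduct.lift_comp_includeLeft (S := ℝ) f.hom.hom g.hom.hom
            fun _ _ => .all _ _).symm
      · exact (congrArg (fun k => k.hom.hom) h₂).trans
          (Algebra.TensorProduct.lift_comp_includeRight (S := ℝ) f.hom.hom g.hom.hom
            fun _ _ => .all _ _).symm)

/-! ### The algebras in use -/

/-- `ℝ` as a Weil algebra. -/
abbrev wR : WeilAlg := ⟨.of ℝ ℝ, isWeilAlg_real⟩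

/-- `ℝ[X]` as a cahiers algebra. -/
abbrev polyX : CahiersAlg := ⟨.of ℝ (Polynomial ℝ), isCahiersAlg_polynomial⟩

/-- `ℝ[X]/(X²)`. -/
abbrev Alg1 : Type := Polynomial ℝ ⧸ Ideal.span {(Polynomial.X : Polynomial ℝ) ^ 2}

/-- `ℝ[X,Y]/(X²,Y²,XY)`. -/
abbrev Alg2 : Type := MvPolynomial (Fin 2) ℝ ⧸
  Ideal.span {(MvPolynomial.X 0 : MvPolynomial (Fin 2) ℝ) ^ 2, MvPolynomial.X 1 ^ 2,
    MvPolynomial.X 0 * MvPolynomial.X 1}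

namespace Alg1

/-- The class of `X`. -/
def x : Alg1 := Ideal.Quotient.mkₐ ℝ _ Polynomial.X

theorem x_sq : x ^ 2 = 0 := by
  rw [x, ← map_pow]
  exact Ideal.Quotient.eq_zero_iff_mem.2 (Ideal.subset_span rfl)

/-- The homomorphism out of `ℝ[X]/(X²)` with a given value, of square zero, at `X`. -/
def lift {A : Type} [CommRing A] [Algebra ℝ A] (a : A) (h : a ^ 2 = 0) : Alg1 →ₐ[ℝ] A :=
  Ideal.Quotient.liftₐ _ (Polynomial.aeval a) fun p hp => by
    have : Ideal.span {(Polynomial.X : Polynomial ℝ) ^ 2} ≤ RingHom.ker (Polynomial.aeval a) := by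
      rw [Ideal.span_le]
      rintro _ rfl
      rw [SetLike.mem_coe, RingHom.mem_ker, map_pow, Polynomial.aeval_X, h]
    exact this hp

@[simp] theorem lift_x {A : Type} [CommRing A] [Algebra ℝ A] (a : A) (h : a ^ 2 = 0) :
    lift a h x = a :=
  Polynomial.aeval_X a

theorem hom_ext {A : Type} [CommRing A] [Algebra ℝ A] {f g : Alg1 →ₐ[ℝ] A} (h : f x = g x) :
    f = g :=
  Ideal.Quotient.algHom_ext _ (Polynomial.algHom_ext h)

theorem isWeilAlg : IsWeilAlg (.of ℝ Alg1) := by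
  have : Module.Finite ℝ Alg1 := (Polynomial.monic_X_pow 2).finite_quotient
  refine isWeilAlg_of _ (lift 0 (by simp)) fun y => ?_
  obtain ⟨p, rfl⟩ := Ideal.Quotient.mkₐ_surjective ℝ _ y
  induction p using Polynomial.induction_on' with
  | add p q hp hq =>
    rw [map_add, map_add, map_add, add_sub_add_comm]
    exact (Commute.all _ _).isNilpotent_add hp hq
  | monomial n a =>
    rcases n with _ | n
    · rw [Polynomial.monomial_zero_left, ← Polynomial.algebraMap_eq, AlgHom.commutes,
        AlgHom.commutes]
      simp
    · have : Ideal.Quotient.mkₐ ℝ _ (Polynomial.monomial (n + 1) a) =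
          x * (algebraMap ℝ Alg1 a * x ^ n) := by
        rw [x, ← AlgHom.commutes (Ideal.Quotient.mkₐ ℝ _), ← map_pow, ← map_mul, ← map_mul,
          ← Polynomial.C_mul_X_pow_eq_monomial, Polynomial.algebraMap_eq]
        congr 1
        ring
      rw [this, map_mul, lift_x, zero_mul, map_zero, sub_zero]
      exact (Commute.all _ _).isNilpotent_mul_right ⟨2, x_sq⟩

end Alg1

namespace Alg2

/-- The class of `X`. -/
def x : Alg2 := Ideal.Quotient.mkₐ ℝ _ (MvPolynomial.X 0)

/-- The class of `Y`. -/
def y : Alg2 := Ideal.Quotient.mkₐ ℝ _ (MvPolynomial.X 1)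

theorem x_sq : x ^ 2 = 0 := by
  rw [x, ← map_pow]
  exact Ideal.Quotient.eq_zero_iff_mem.2 (Ideal.subset_span (by simp))

theorem y_sq : y ^ 2 = 0 := by
  rw [y, ← map_pow]
  exact Ideal.Quotient.eq_zero_iff_mem.2 (Ideal.subset_span (by simp))

theorem x_mul_y : x * y = 0 := by
  rw [x, y, ← map_mul]
  exact Ideal.Quotient.eq_zero_iff_mem.2 (Ideal.subset_span (by simp))

/-- The homomorphism out of `ℝ[X,Y]/(X²,Y²,XY)` with given values at `X` and `Y`. -/
def lift {A : Type} [CommRing A] [Algebra ℝ A] (a b : A) (ha : a ^ 2 = 0) (hb : b ^ 2 = 0)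
    (hab : a * b = 0) : Alg2 →ₐ[ℝ] A :=
  Ideal.Quotient.liftₐ _ (MvPolynomial.aeval ![a, b]) fun p hp => by
    have : Ideal.span {(MvPolynomial.X 0 : MvPolynomial (Fin 2) ℝ) ^ 2, MvPolynomial.X 1 ^ 2,
        MvPolynomial.X 0 * MvPolynomial.X 1} ≤ RingHom.ker (MvPolynomial.aeval ![a, b]) := by
      rw [Ideal.span_le]
      rintro _ (rfl | rfl | rfl) <;> simp [ha, hb, hab]
    exact this hp

section
variable {A : Type} [CommRing A] [Algebra ℝ A] (a b : A) (ha : a ^ 2 = 0) (hb : b ^ 2 = 0)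
    (hab : a * b = 0)

@[simp] theorem lift_x : lift a b ha hb hab x = a :=
  MvPolynomial.aeval_X ![a, b] 0

@[simp] theorem lift_y : lift a b ha hb hab y = b :=
  MvPolynomial.aeval_X ![a, b] 1

end

theorem hom_ext {A : Type} [CommRing A] [Algebra ℝ A] {f g : Alg2 →ₐ[ℝ] A} (hx : f x = g x)
    (hy : f y = g y) : f = g :=
  Ideal.Quotient.algHom_ext _ (MvPolynomial.algHom_ext fun i => by fin_cases i <;> assumption)

theorem isWeilAlg : IsWeilAlg (.of ℝ Alg2) := by
  have hnil : ∀ i, IsNilpotent (Ideal.Quotient.mkₐ ℝ (Ideal.span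
      {(MvPolynomial.X 0 : MvPolynomial (Fin 2) ℝ) ^ 2, MvPolynomial.X 1 ^ 2,
        MvPolynomial.X 0 * MvPolynomial.X 1}) (MvPolynomial.X i)) := by
    intro i
    fin_cases i
    exacts [⟨2, x_sq⟩, ⟨2, y_sq⟩]
  have h1 : ∀ i, lift (0 : ℝ) 0 (by simp) (by simp) (by simp) (Ideal.Quotient.mkₐ ℝ _
      (MvPolynomial.X i)) = 0 := by
    intro i
    fin_cases i
    exacts [lift_x .., lift_y ..]
  have : Module.Finite ℝ Alg2 := by
    have : Algebra.IsIntegral ℝ Alg2 := by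
      refine ⟨fun z => ?_⟩
      obtain ⟨p, rfl⟩ := Ideal.Quotient.mkₐ_surjective ℝ _ z
      induction p using MvPolynomial.induction_on with
      | C a =>
        rw [← MvPolynomial.algebraMap_eq, AlgHom.commutes]
        exact isIntegral_algebraMap
      | add p q hp hq => rw [map_add]; exact hp.add hq
      | mul_X p i hp =>
        rw [map_mul]
        obtain ⟨n, hn⟩ := hnil i
        refine hp.mul (IsIntegral.of_pow (n := n + 1) (by simp) ?_)
        exact (pow_succ _ n).trans (by rw [hn, zero_mul]) ▸ isIntegral_zero
    exact Algebra.IsIntegral.finite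
  refine isWeilAlg_of _ (lift 0 0 (by simp) (by simp) (by simp)) fun z => ?_
  obtain ⟨p, rfl⟩ := Ideal.Quotient.mkₐ_surjective ℝ _ z
  induction p using MvPolynomial.induction_on with
  | C a =>
    rw [← MvPolynomial.algebraMap_eq, AlgHom.commutes, AlgHom.commutes]
    simp
  | add p q hp hq =>
    rw [map_add, map_add, map_add, add_sub_add_comm]
    exact (Commute.all _ _).isNilpotent_add hp hq
  | mul_X p i hp =>
    rw [map_mul, map_mul, h1, mul_zero, map_zero, sub_zero]
    exact (Commute.all _ _).isNilpotent_mul_left (hnil i)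

end Alg2

/-- The Weil algebra `ℝ[X]/(X²)`. -/
abbrev w1 : WeilAlg := ⟨.of ℝ Alg1, Alg1.isWeilAlg⟩

/-- The Weil algebra `ℝ[X,Y]/(X²,Y²,XY)`. -/
abbrev w2 : WeilAlg := ⟨.of ℝ Alg2, Alg2.isWeilAlg⟩

/-- An algebra homomorphism between Weil algebras as a morphism. -/
abbrev wHom {V W : WeilAlg} (f : V.obj →ₐ[ℝ] W.obj) : V ⟶ W :=
  ObjectProperty.homMk (CommAlgCat.ofHom f)

/-- An algebra homomorphism between cahiers algebras as a morphism. -/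
abbrev cHom {A B : CahiersAlg} (f : A.obj →ₐ[ℝ] B.obj) : A ⟶ B :=
  ObjectProperty.homMk (CommAlgCat.ofHom f)

/-- `ℝ[X]/(X²) → ℝ`, `X ↦ 0`. -/
def aug1 : w1 ⟶ wR := wHom (Alg1.lift (0 : ℝ) (by simp))

/-- `ℝ[X,Y]/(X²,Y²,XY) → ℝ`, `X, Y ↦ 0`. -/
def aug2 : w2 ⟶ wR := wHom (Alg2.lift (0 : ℝ) 0 (by simp) (by simp) (by simp))

/-- `ℝ[X,Y]/(X²,Y²,XY) → ℝ[X]/(X²)`, `(X, Y) ↦ (X, 0)`. -/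
def proj1 : w2 ⟶ w1 := wHom (Alg2.lift Alg1.x 0 Alg1.x_sq (by simp) (by simp))

/-- `ℝ[X,Y]/(X²,Y²,XY) → ℝ[Y]/(Y²)`, `(X, Y) ↦ (0, Y)`. -/
def proj2 : w2 ⟶ w1 := wHom (Alg2.lift 0 Alg1.x (by simp) Alg1.x_sq (by simp))

/-- `ℝ[X,Y]/(X²,Y²,XY) → ℝ[X]/(X²)`, `(X, Y) ↦ (X, X)`. -/
def fold : w2 ⟶ w1 :=
  wHom (Alg2.lift Alg1.x Alg1.x Alg1.x_sq Alg1.x_sq (by rw [← sq, Alg1.x_sq]))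

theorem proj1_aug : proj1 ≫ aug1 = aug2 := by
  have : (Alg1.lift (0 : ℝ) (by simp)).comp
      (Alg2.lift Alg1.x 0 Alg1.x_sq (by simp) (by simp)) =
      Alg2.lift (0 : ℝ) 0 (by simp) (by simp) (by simp) := Alg2.hom_ext (by simp) (by simp)
  exact congrArg (wHom (V := w2) (W := wR)) this

theorem proj2_aug : proj2 ≫ aug1 = aug2 := by
  have : (Alg1.lift (0 : ℝ) (by simp)).comp
      (Alg2.lift 0 Alg1.x (by simp) Alg1.x_sq (by simp)) =
      Alg2.lift (0 : ℝ) 0 (by simp) (by simp) (by simp) := Alg2.hom_ext (by simp) (by simp)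
  exact congrArg (wHom (V := w2) (W := wR)) this

theorem fold_aug : fold ≫ aug1 = aug2 := by
  have : (Alg1.lift (0 : ℝ) (by simp)).comp
      (Alg2.lift Alg1.x Alg1.x Alg1.x_sq Alg1.x_sq (by rw [← sq, Alg1.x_sq])) =
      Alg2.lift (0 : ℝ) 0 (by simp) (by simp) (by simp) := Alg2.hom_ext (by simp) (by simp)
  exact congrArg (wHom (V := w2) (W := wR)) this

/-- `ℝ[X] → ℝ[X] ⊗ ℝ[Y] = ℝ[X,Y]`, `X ↦ X + Y`. -/
def coadd : polyX ⟶ polyX.tensor polyX :=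
  cHom (Polynomial.aeval
    (Polynomial.X ⊗ₜ[ℝ] (1 : Polynomial ℝ) + (1 : Polynomial ℝ) ⊗ₜ[ℝ] Polynomial.X))

/-- `ℝ[X] → ℝ[X] ⊗ ℝ[Y] = ℝ[X,Y]`, `X ↦ XY`. -/
def comul : polyX ⟶ polyX.tensor polyX :=
  cHom (Polynomial.aeval ((Polynomial.X : Polynomial ℝ) ⊗ₜ[ℝ] (Polynomial.X : Polynomial ℝ)))

/-- `ℝ[X] → ℝ`, `X ↦ 1`. -/
def coone : polyX ⟶ weilToCahiers.obj wR :=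
  cHom (Polynomial.aeval (1 : ℝ))

/-- `ℝ[X]/(X²) → ℝ[X]/(X²) ⊗ ℝ[Y] = ℝ[X,Y]/(X²)`, `X ↦ XY`. -/
def coact : weilToCahiers.obj w1 ⟶ (weilToCahiers.obj w1).tensor polyX :=
  cHom (Alg1.lift (Alg1.x ⊗ₜ[ℝ] (Polynomial.X : Polynomial ℝ) : Alg1 ⊗[ℝ] Polynomial ℝ)
    (by rw [Algebra.TensorProduct.tmul_pow, Alg1.x_sq, TensorProduct.zero_tmul]))

/-- `ℝ` is the initial cahiers algebra. -/
def isInitialReal : IsInitial (weilToCahiers.obj wR) :=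
  IsInitial.ofUniqueHom
    (fun A => ObjectProperty.homMk (CommAlgCat.ofHom (Algebra.ofId ℝ A.obj)))
    (fun _ _ => by ext1; ext1; exact Algebra.ext_id _ _ _)

/-! ### Modules over ring objects -/

section RingModule

variable {C : Type u} [Category.{v} C] [CartesianMonoidalCategory C] [BraidedCategory C]

open scoped MonObj AddMonObj

/-- A (unital, left) module object over a ring object `R` in a category with finite products: a
commutative additive group object `V` with an action `R ⊗ V ⟶ V` of the multiplicative monoid of
`R` that is additive in both variables, i.e. `r (v + w) = r v + r w` and `(r + s) v = r v + s v`. -/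
class RingModObj (R : C) [RingObj R] (V : C) extends AddGrpObj V, IsCommAddMonObj V, ModObj R V where
  smul_add : R ◁ σ[V] ≫ smul = lift (R ◁ fst V V ≫ smul) (R ◁ snd V V ≫ smul) ≫ σ[V]
  add_smul : σ[R] ▷ V ≫ smul = lift (fst R R ▷ V ≫ smul) (snd R R ▷ V ≫ smul) ≫ σ[V]

end RingModule

/-! ### Weil categories

A Weil category is a topos `K` with a functor `D : CahiersAlgᵒᵖ ⥤ K` preserving finite products. -/

section

variable {K : Type u} [Category.{v} K] [CartesianMonoidalCategory K]
  (D : CahiersAlgᵒᵖ ⥤ K)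

section Line

variable [PreservesFiniteProducts D]

/-- `D(ℝ)` is terminal. -/
def isTerminalReal : IsTerminal (D.obj (op (weilToCahiers.obj wR))) :=
  IsTerminal.isTerminalObj D _ (terminalOpOfInitial isInitialReal)

/-- `1 = D(ℝ)`. -/
def unitIso : 𝟙_ K ≅ D.obj (op (weilToCahiers.obj wR)) :=
  isTerminalTensorUnit.uniqueUpToIso (isTerminalReal D)

theorem isIso_comparison (A B : CahiersAlg) :
    IsIso (lift (D.map (A.inl B).op) (D.map (A.inr B).op)) := by
  have h := mapIsLimitOfPreservesOfIsLimit D _ _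
    (BinaryCofan.IsColimit.op (CahiersAlg.isColimit A B))
  have h' := tensorProductIsBinaryProduct (D.obj (op A)) (D.obj (op B))
  have e : lift (D.map (A.inl B).op) (D.map (A.inr B).op) =
      (h.conePointUniqueUpToIso h').hom :=
    CartesianMonoidalCategory.hom_ext _ _
      ((lift_fst _ _).trans (h.conePointUniqueUpToIso_hom_comp h' ⟨.left⟩).symm)
      ((lift_snd _ _).trans (h.conePointUniqueUpToIso_hom_comp h' ⟨.right⟩).symm)
  rw [e]
  exact Iso.isIso_hom _

/-- `D(A ⊗ B) = D(A) × D(B)`. -/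
def prodIso (A B : CahiersAlg) : D.obj (op (A.tensor B)) ≅ D.obj (op A) ⊗ D.obj (op B) :=
  have := isIso_comparison D A B
  asIso (lift (D.map (A.inl B).op) (D.map (A.inr B).op))

/-- The line object `D(ℝ[X])`. -/
abbrev line : K := D.obj (op polyX)

/-- Addition on the line object. -/
def lineAdd : line D ⊗ line D ⟶ line D := (prodIso D polyX polyX).inv ≫ D.map coadd.op

/-- Multiplication on the line object. -/
def lineMul : line D ⊗ line D ⟶ line D := (prodIso D polyX polyX).inv ≫ D.map comul.op

/-- The unity of the line object. -/
def lineOne : 𝟙_ K ⟶ line D := (unitIso D).hom ≫ D.map coone.op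

/-- The infinitesimal object `D(ℝ[X]/(X²))`. -/
abbrev dObj : K := D.obj (op (weilToCahiers.obj w1))

/-- The action of the line object on `D(ℝ[X]/(X²))`. -/
def dAct : dObj D ⊗ line D ⟶ dObj D :=
  (prodIso D (weilToCahiers.obj w1) polyX).inv ≫ D.map coact.op

end Line

section Prolongation

variable [MonoidalClosed K]

/-- The functor `W ↦ M^{D(W)}`. -/
def prolong (M : K) : WeilAlg ⥤ K :=
  (weilToCahiers ⋙ D.rightOp) ⋙ MonoidalClosed.internalHom.flip.obj M

/-- `M` is microlinear when `W ↦ M^{D(W)}` sends to limit cones all cones of Weil algebras over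
finite diagrams that are limit cones of `ℝ`-algebras. -/
def Microlinear (M : K) : Prop :=
  ∀ (J : Type) [SmallCategory J] [FinCategory J] (F : J ⥤ WeilAlg) (c : Cone F),
    Nonempty (IsLimit (IsWeilAlg.ι.mapCone c)) → Nonempty (IsLimit ((prolong D M).mapCone c))

variable [PreservesFiniteProducts D]

/-- The identification `M^{D(ℝ)} = M`: evaluation at the point of `D(ℝ) = 1`. -/
def prolongReal (M : K) : (prolong D M).obj wR ⟶ M :=
  (λ_ _).inv ≫ ((unitIso D).hom ▷ _) ≫ (ihom.ev (D.obj (op (weilToCahiers.obj wR)))).app M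

/-- The scalar multiplication `ℝ × M^D ⟶ M^D`: the transpose of
`D × (ℝ × M^D) ⟶ D × M^D ⟶ M`, the action on `D` followed by evaluation. -/
def scalar (M : K) : line D ⊗ (prolong D M).obj w1 ⟶ (prolong D M).obj w1 :=
  MonoidalClosed.curry (A := dObj D) (Y := line D ⊗ (prolong D M).obj w1) (X := M)
    ((α_ _ _ _).inv ≫ (dAct D ▷ _) ≫ (ihom.ev (dObj D)).app M)

/-- `M^{D(W)}` as an object over `M`, for a Weil algebra `W` with its augmentation `e`. -/
def prolongOver (M : K) {W : WeilAlg} (e : W ⟶ wR) : Over M :=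
  Over.mk ((prolong D M).map e ≫ prolongReal D M)

/-- The morphism over `M` induced by a homomorphism of Weil algebras. -/
def prolongOverMap (M : K) {V W : WeilAlg} {d : V ⟶ wR} {e : W ⟶ wR} (f : V ⟶ W)
    (h : f ≫ e = d) : prolongOver D M d ⟶ prolongOver D M e :=
  Over.homMk ((prolong D M).map f) (by
    subst h
    simp [prolongOver])

/-- The tangent bundle `M^D ⟶ M`. -/
abbrev tangent (M : K) : Over M := prolongOver D M aug1

end Prolongation

section Slice

variable [PreservesFiniteProducts D] [HasPullbacks K]

attribute [local instance] Over.cartesianMonoidalCategory Over.braidedCategory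

/-- The object `ℝ × M ⟶ M` of the slice over `M`. -/
abbrev lineOver (M : K) : Over M := Over.mk (snd (line D) M)

/-- A binary operation `f` on `ℝ` gives the operation `((r, m), (s, m)) ↦ (f (r, s), m)` on
`ℝ × M ⟶ M` in the slice over `M`. -/
def fiberwise (M : K) (f : line D ⊗ line D ⟶ line D) :
    lineOver D M ⊗ lineOver D M ⟶ lineOver D M :=
  Over.homMk (lift
    (lift ((fst (lineOver D M) (lineOver D M)).left ≫ fst (line D) M)
      ((snd (lineOver D M) (lineOver D M)).left ≫ fst (line D) M) ≫ f)
    ((fst (lineOver D M) (lineOver D M)).left ≫ snd (line D) M)) (by simp)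

/-- The unity `m ↦ (1, m)` of `ℝ × M ⟶ M`. -/
def fiberwiseOne (M : K) : 𝟙_ (Over M) ⟶ lineOver D M :=
  Over.homMk (lift (toUnit M ≫ lineOne D) (𝟙 M)) (by simp)

end Slice

end

end WeilCat

end

open WeilCat
open scoped MonObj AddMonObj

attribute [local instance] CategoryTheory.Over.cartesianMonoidalCategory
  CategoryTheory.Over.braidedCategory

noncomputable section

namespace WeilCat

/-! ### Pullbacks of algebras -/

/-! The axioms are checked on generalized elements, where each becomes an identity in ordinary
algebra.

For the line: since `D` turns tensor products into products, any three maps `T ⟶ line D` come from a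
single `α : T ⟶ D(A)` and three elements of a cahiers algebra `A` (`exists_elt₃`). Addition and
multiplication of points are then addition and multiplication in `A`, and the ring laws over `M`
follow from those of `A`.

For addition of tangent vectors: microlinearity turns fibre products of Weil algebras over ℝ into
pullbacks of prolongations. Hence up to three vectors with a common base point are images of one
point of `M^{D(W)}` under homomorphisms `W ⟶ w1` (`exists_tangent₃`). Their sum is given by `addHom`
(`vec_lift_tangentAdd_of_eq_map`), for which `W ⟶ w1` is an abelian group: in coordinates one adds
and subtracts the common constant term (`addHom_apply`).

For scalars: a homomorphism `V ⟶ W ⊗ A` together with `α` sends points of `M^{D(V)}` to points of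
`M^{D(W)}` (`act`), functorially (`act_act`), and the scalar `a` acts through `X ↦ aX`
(`lift_scalar`). Distributivity is obtained by exhibiting points of `M^{D(2)}`: scaling `X` and `Y`
together yields `r(v + w)`, while `X ↦ aX + bY` yields `(r + s)v`. -/

/-- The fibre product of algebras is the equalizer subalgebra `S` of `B × C`. The two element
conditions make `A → S` bijective, and its inverse supplies the universal lifts. -/
theorem isPullback_commAlgCat {A B C E : CommAlgCat.{0} ℝ} {f : A ⟶ B} {g : A ⟶ C} {h : B ⟶ E}
    {k : C ⟶ E} (comm : f ≫ h = g ≫ k)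
    (hinj : ∀ a a' : A, f.hom a = f.hom a' → g.hom a = g.hom a' → a = a')
    (hsurj : ∀ (b : B) (c : C), h.hom b = k.hom c → ∃ a : A, f.hom a = b ∧ g.hom a = c) :
    IsPullback f g h k := by
  let S : Subalgebra ℝ (B × C) :=
    AlgHom.equalizer (h.hom.comp (AlgHom.fst ℝ B C)) (k.hom.comp (AlgHom.snd ℝ B C))
  let φ : A →ₐ[ℝ] S := (f.hom.prod g.hom).codRestrict S fun a =>
    congrArg (fun q : A ⟶ E => q.hom a) comm
  have hφ : Function.Bijective φ := by
    refine ⟨fun a a' haa => ?_, fun s => ?_⟩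
    · have h2 := congrArg Subtype.val haa
      exact hinj a a' (congrArg Prod.fst h2) (congrArg Prod.snd h2)
    · obtain ⟨a, h1, h2⟩ := hsurj s.1.1 s.1.2 s.2
      exact ⟨a, Subtype.ext (Prod.ext h1 h2)⟩
  let ψ : A ≃ₐ[ℝ] S := AlgEquiv.ofBijective φ hφ
  have hf : ∀ s, f.hom (ψ.symm s) = s.1.1 := fun s =>
    congrArg (fun r : S => r.1.1) (ψ.apply_symm_apply s)
  have hg : ∀ s, g.hom (ψ.symm s) = s.1.2 := fun s =>
    congrArg (fun r : S => r.1.2) (ψ.apply_symm_apply s)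
  refine ⟨⟨comm⟩, ⟨PullbackCone.IsLimit.mk comm (fun s => CommAlgCat.ofHom
    ((ψ.symm : S →ₐ[ℝ] A).comp ((s.fst.hom.prod s.snd.hom).codRestrict S fun a =>
      congrArg (fun q : s.pt ⟶ E => q.hom a) s.condition))) ?_ ?_ ?_⟩⟩
  · intro s
    ext a
    exact hf _
  · intro s
    ext a
    exact hg _
  · intro s m h1 h2
    ext a
    refine hinj _ _ ?_ ?_
    · exact (congrArg (fun q : s.pt ⟶ B => q.hom a) h1).trans
        (hf ⟨(s.fst.hom a, s.snd.hom a), congrArg (fun q : s.pt ⟶ E => q.hom a) s.condition⟩).symm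
    · exact (congrArg (fun q : s.pt ⟶ C => q.hom a) h2).trans
        (hg ⟨(s.fst.hom a, s.snd.hom a), congrArg (fun q : s.pt ⟶ E => q.hom a) s.condition⟩).symm

theorem Alg1.exists_eq (z : Alg1) : ∃ c a : ℝ, z = algebraMap ℝ Alg1 c + a • Alg1.x := by
  obtain ⟨p, rfl⟩ := Ideal.Quotient.mkₐ_surjective ℝ _ z
  induction p using Polynomial.induction_on with
  | C c => exact ⟨c, 0, by rw [zero_smul, add_zero]; rfl⟩
  | add p q hp hq =>
    obtain ⟨c, a, h⟩ := hp
    obtain ⟨c', a', h'⟩ := hq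
    refine ⟨c + c', a + a', ?_⟩
    rw [map_add, h, h', map_add]
    module
  | monomial n r h =>
    obtain ⟨c, a, h⟩ := h
    -- Multiplying `c + aX` by `X` kills `aX`, so the old constant term becomes the new coefficient
    -- of `X`.
    refine ⟨0, c, ?_⟩
    rw [show Polynomial.C r * Polynomial.X ^ (n + 1) =
      Polynomial.C r * Polynomial.X ^ n * Polynomial.X by ring, map_mul, h]
    change (_ + _) * Alg1.x = _
    rw [add_mul, smul_mul_assoc, ← sq, Alg1.x_sq, Algebra.algebraMap_eq_smul_one, smul_mul_assoc,
      one_mul, map_zero, smul_zero, add_zero, zero_add]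

theorem Alg2.exists_eq (z : Alg2) :
    ∃ c a b : ℝ, z = algebraMap ℝ Alg2 c + a • Alg2.x + b • Alg2.y := by
  obtain ⟨p, rfl⟩ := Ideal.Quotient.mkₐ_surjective ℝ _ z
  induction p using MvPolynomial.induction_on with
  | C c => exact ⟨c, 0, 0, by rw [zero_smul, zero_smul, add_zero, add_zero]; rfl⟩
  | add p q hp hq =>
    obtain ⟨c, a, b, h⟩ := hp
    obtain ⟨c', a', b', h'⟩ := hq
    refine ⟨c + c', a + a', b + b', ?_⟩
    rw [map_add, h, h', map_add]
    module
  | mul_X p i h =>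
    obtain ⟨c, a, b, h⟩ := h
    rw [map_mul, h]
    fin_cases i
    · refine ⟨0, c, 0, ?_⟩
      change (_ + _) * Alg2.x = _
      rw [add_mul, add_mul, smul_mul_assoc, smul_mul_assoc, ← sq, Alg2.x_sq, mul_comm Alg2.y,
        Alg2.x_mul_y, Algebra.algebraMap_eq_smul_one, smul_mul_assoc, one_mul, map_zero]
      module
    · refine ⟨0, 0, c, ?_⟩
      change (_ + _) * Alg2.y = _
      rw [add_mul, add_mul, smul_mul_assoc, smul_mul_assoc, ← sq, Alg2.y_sq,
        Alg2.x_mul_y, Algebra.algebraMap_eq_smul_one, smul_mul_assoc, one_mul, map_zero]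
      module

/-- The dual numbers are a model in which both coordinates can be read off directly. -/
theorem Alg1.algebraMap_add_smul_x_inj {c a c' a' : ℝ}
    (h : algebraMap ℝ Alg1 c + a • Alg1.x = algebraMap ℝ Alg1 c' + a' • Alg1.x) :
    c = c' ∧ a = a' := by
  have h1 := congrArg (Alg1.lift (DualNumber.eps : DualNumber ℝ) (by simp [sq])) h
  simp only [map_add, map_smul, AlgHom.commutes, Alg1.lift_x] at h1
  have h2 := congrArg TrivSqZeroExt.fst h1
  have h3 := congrArg TrivSqZeroExt.snd h1
  simpa [TrivSqZeroExt.algebraMap_eq_inl] using And.intro h2 h3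

/-! ### The fibre square in coordinates -/

theorem proj1_apply (c a b : ℝ) :
    proj1.hom.hom (algebraMap ℝ Alg2 c + a • Alg2.x + b • Alg2.y) =
      algebraMap ℝ Alg1 c + a • Alg1.x := by
  change Alg2.lift Alg1.x 0 Alg1.x_sq (by simp) (by simp) _ = _
  simp

theorem proj2_apply (c a b : ℝ) :
    proj2.hom.hom (algebraMap ℝ Alg2 c + a • Alg2.x + b • Alg2.y) =
      algebraMap ℝ Alg1 c + b • Alg1.x := by
  change Alg2.lift 0 Alg1.x (by simp) Alg1.x_sq (by simp) _ = _
  simp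

theorem fold_apply (c a b : ℝ) :
    fold.hom.hom (algebraMap ℝ Alg2 c + a • Alg2.x + b • Alg2.y) =
      algebraMap ℝ Alg1 c + (a + b) • Alg1.x := by
  change Alg2.lift Alg1.x Alg1.x Alg1.x_sq Alg1.x_sq (by rw [← sq, Alg1.x_sq]) _ = _
  simp [add_smul, add_assoc]

theorem aug1_apply (c a : ℝ) :
    aug1.hom.hom (algebraMap ℝ Alg1 c + a • Alg1.x) = c := by
  change Alg1.lift (0 : ℝ) (by simp) _ = _
  simp

/-- An element `c + aX + bY` is the same as a pair `c + aX`, `c + bX` with common constant term. -/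
theorem isPullback_proj_algebra :
    IsPullback (IsWeilAlg.ι.map proj1) (IsWeilAlg.ι.map proj2)
      (IsWeilAlg.ι.map aug1) (IsWeilAlg.ι.map aug1) := by
  refine isPullback_commAlgCat ?_ ?_ ?_
  · rw [← Functor.map_comp, ← Functor.map_comp, proj1_aug, proj2_aug]
  · intro z z' h h'
    obtain ⟨c, a, b, rfl⟩ := Alg2.exists_eq z
    obtain ⟨c', a', b', rfl⟩ := Alg2.exists_eq z'
    obtain ⟨rfl, rfl⟩ := Alg1.algebraMap_add_smul_x_inj
      ((proj1_apply _ _ _).symm.trans (h.trans (proj1_apply _ _ _)))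
    obtain ⟨-, rfl⟩ := Alg1.algebraMap_add_smul_x_inj
      ((proj2_apply _ _ _).symm.trans (h'.trans (proj2_apply _ _ _)))
    rfl
  · intro z z' h
    obtain ⟨c, a, rfl⟩ := Alg1.exists_eq z
    obtain ⟨c', b, rfl⟩ := Alg1.exists_eq z'
    obtain rfl : c = c' := (aug1_apply _ _).symm.trans (h.trans (aug1_apply _ _))
    exact ⟨_, proj1_apply c a b, proj2_apply c a b⟩

theorem isPullback_proj : IsPullback proj1 proj2 aug1 aug1 :=
  isPullback_proj_algebra.of_map IsWeilAlg.ι (proj1_aug.trans proj2_aug.symm)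

/-! ### Augmentations and fibre products over ℝ -/

/-- `w - e(w)` is nilpotent, so `e'` sends it to a nilpotent real number, which is zero. -/
theorem WeilAlg.aug_apply_eq {W : WeilAlg} {e : W.obj →ₐ[ℝ] ℝ}
    (he : IsNilpotent (RingHom.ker e)) (e' : W.obj →ₐ[ℝ] ℝ) : e' = e := by
  ext w
  have h := (isNilpotent_sub he w).map e'
  rw [map_sub, AlgHom.commutes] at h
  exact sub_eq_zero.1 h.eq_zero

/-- A Weil algebra has a unique augmentation. -/
theorem WeilAlg.hom_wR_ext {W : WeilAlg} (e e' : W ⟶ wR) : e = e' := by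
  obtain ⟨-, d, hd⟩ := W.property
  ext1
  ext1
  exact (WeilAlg.aug_apply_eq hd _).trans (WeilAlg.aug_apply_eq hd _).symm

theorem WeilAlg.isNilpotent_sub {W : WeilAlg} (e : W ⟶ wR) (w : W.obj) :
    IsNilpotent (w - algebraMap ℝ W.obj (e.hom.hom w)) := by
  obtain ⟨-, d, hd⟩ := W.property
  have h := WeilCat.isNilpotent_sub hd w
  rwa [← WeilAlg.aug_apply_eq hd e.hom.hom] at h

/-- Weil algebras are stable under fibre products over `ℝ`. -/
theorem WeilAlg.exists_isPullback {V W : WeilAlg} (d : V ⟶ wR) (e : W ⟶ wR) :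
    ∃ (P : WeilAlg) (p : P ⟶ V) (q : P ⟶ W), IsPullback (IsWeilAlg.ι.map p) (IsWeilAlg.ι.map q)
      (IsWeilAlg.ι.map d) (IsWeilAlg.ι.map e) := by
  let S : Subalgebra ℝ (V.obj × W.obj) := AlgHom.equalizer
    (d.hom.hom.comp (AlgHom.fst ℝ V.obj W.obj)) (e.hom.hom.comp (AlgHom.snd ℝ V.obj W.obj))
  have := V.property.1
  have := W.property.1
  have hS : IsWeilAlg (.of ℝ S) := by
    refine isWeilAlg_of S ((d.hom.hom.comp (AlgHom.fst ℝ V.obj W.obj)).comp S.val) fun s => ?_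
    obtain ⟨m, hm⟩ := WeilAlg.isNilpotent_sub d s.1.1
    obtain ⟨n, hn⟩ := WeilAlg.isNilpotent_sub e s.1.2
    -- The exponent `m + n` kills both components at once.
    refine ⟨m + n, Subtype.ext (Prod.ext ?_ ?_)⟩
    · refine Eq.trans ?_ ((pow_add _ m n).trans ((congrArg (· * _) hm).trans (zero_mul _)))
      rfl
    · refine Eq.trans ?_ ((pow_add _ m n).trans ((congrArg (_ * ·) hn).trans (mul_zero _)))
      -- The augmentation of `S` is read off the first component; membership in the equalizer lets
      -- the second component compute it too.
      refine congrArg (fun r : ℝ => (s.1.2 - algebraMap ℝ W.obj r) ^ (m + n)) s.2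
  refine ⟨⟨.of ℝ S, hS⟩, wHom ((AlgHom.fst ℝ V.obj W.obj).comp S.val),
    wHom ((AlgHom.snd ℝ V.obj W.obj).comp S.val), isPullback_commAlgCat ?_ ?_ ?_⟩
  · ext s
    exact s.2
  · exact fun s s' h h' => Subtype.ext (Prod.ext h h')
  · exact fun b c h => ⟨⟨(b, c), h⟩, rfl, rfl⟩

/-! ### Tangent vectors of Weil algebras

Homomorphisms from a Weil algebra to `ℝ[X]/(X²)` form an abelian group. -/

/-- The sum of two homomorphisms to `ℝ[X]/(X²)`. -/
def addHom {W : WeilAlg} (f g : W ⟶ w1) : W ⟶ w1 :=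
  isPullback_proj.lift f g (WeilAlg.hom_wR_ext _ _) ≫ fold

/-- The inclusion of `ℝ` into `ℝ[X]/(X²)`. -/
def unit1 : wR ⟶ w1 := wHom (Algebra.ofId ℝ Alg1)

/-- `ℝ[X]/(X²) → ℝ[X]/(X²)`, `X ↦ -X`. -/
def neg1 : w1 ⟶ w1 := wHom (Alg1.lift (-Alg1.x) ((neg_sq Alg1.x).trans Alg1.x_sq))

/-- In coordinates, `c + (a + b)X = (c + aX) + (c + bX) - c`. -/
theorem fold_eq (z : Alg2) :
    fold.hom.hom z = proj1.hom.hom z + proj2.hom.hom z -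
      (algebraMap ℝ Alg1 (aug1.hom.hom (proj1.hom.hom z)) : Alg1) := by
  obtain ⟨c, a, b, rfl⟩ := Alg2.exists_eq z
  rw [fold_apply, proj1_apply, proj2_apply, aug1_apply, add_smul]
  abel

/-- With this formula the universal property disappears from the group laws: since all maps `W ⟶ w1`
have the same constant term, they become computations in an additive group. -/
theorem addHom_apply {W : WeilAlg} (f g : W ⟶ w1) (w : W.obj) :
    (addHom f g).hom.hom w = f.hom.hom w + g.hom.hom w -
      algebraMap ℝ Alg1 (aug1.hom.hom (f.hom.hom w)) := by
  have h := WeilAlg.hom_wR_ext (f ≫ aug1) (g ≫ aug1)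
  have h1 := congrArg (fun q : W ⟶ w1 => q.hom.hom w) (isPullback_proj.lift_fst f g h)
  have h2 := congrArg (fun q : W ⟶ w1 => q.hom.hom w) (isPullback_proj.lift_snd f g h)
  dsimp at h1 h2
  rw [← h1, ← h2]
  exact fold_eq _

theorem WeilAlg.hom_ext {V W : WeilAlg} {f g : V ⟶ W} (h : ∀ v, f.hom.hom v = g.hom.hom v) :
    f = g := by
  ext1
  ext v
  exact h v

theorem aug1_addHom {W : WeilAlg} (f g : W ⟶ w1) (w : W.obj) :
    aug1.hom.hom ((addHom f g).hom.hom w) = aug1.hom.hom (f.hom.hom w) :=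
  congrArg (fun q : W ⟶ wR => q.hom.hom w)
    (WeilAlg.hom_wR_ext (addHom f g ≫ aug1) (f ≫ aug1))

theorem aug1_eq {W : WeilAlg} (f g : W ⟶ w1) (w : W.obj) :
    aug1.hom.hom (f.hom.hom w) = aug1.hom.hom (g.hom.hom w) :=
  congrArg (fun q : W ⟶ wR => q.hom.hom w) (WeilAlg.hom_wR_ext (f ≫ aug1) (g ≫ aug1))

theorem addHom_assoc {W : WeilAlg} (f g h : W ⟶ w1) :
    addHom (addHom f g) h = addHom f (addHom g h) := by
  refine WeilAlg.hom_ext fun w => ?_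
  rw [addHom_apply (addHom f g), aug1_addHom, addHom_apply, addHom_apply, addHom_apply,
    aug1_eq g f]
  abel

theorem addHom_comm {W : WeilAlg} (f g : W ⟶ w1) : addHom f g = addHom g f := by
  refine WeilAlg.hom_ext fun w => ?_
  rw [addHom_apply, addHom_apply, aug1_eq g f]
  abel

theorem addHom_unit {W : WeilAlg} (f : W ⟶ w1) (e : W ⟶ wR) : addHom f (e ≫ unit1) = f := by
  refine WeilAlg.hom_ext fun w => ?_
  rw [addHom_apply, WeilAlg.hom_wR_ext e (f ≫ aug1)]
  exact add_sub_cancel_right _ _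

theorem addHom_neg {W : WeilAlg} (f : W ⟶ w1) (e : W ⟶ wR) :
    addHom f (f ≫ neg1) = e ≫ unit1 := by
  refine WeilAlg.hom_ext fun w => ?_
  rw [addHom_apply, WeilAlg.hom_wR_ext e (f ≫ aug1)]
  change f.hom.hom w + neg1.hom.hom (f.hom.hom w) - _ =
    algebraMap ℝ Alg1 (aug1.hom.hom (f.hom.hom w))
  obtain ⟨c, a, h⟩ := Alg1.exists_eq (f.hom.hom w)
  rw [h, aug1_apply]
  have : neg1.hom.hom (algebraMap ℝ Alg1 c + a • Alg1.x) = algebraMap ℝ Alg1 c - a • Alg1.x := by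
    change Alg1.lift (-Alg1.x) ((neg_sq Alg1.x).trans Alg1.x_sq) _ = _
    simp [sub_eq_add_neg]
  rw [this]
  abel

end WeilCat

end

noncomputable section

namespace WeilCat

/-! ### Homomorphisms of cahiers algebras -/

theorem CahiersAlg.hom_ext {A B : CahiersAlg} {f g : A ⟶ B} (h : f.hom.hom = g.hom.hom) :
    f = g := by
  ext1
  ext1
  exact h

/-- The copairing of homomorphisms of cahiers algebras. -/
def CahiersAlg.desc {A B C : CahiersAlg} (f : A ⟶ C) (g : B ⟶ C) : A.tensor B ⟶ C :=
  cHom (Algebra.TensorProduct.lift f.hom.hom g.hom.hom fun _ _ => .all _ _)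

theorem CahiersAlg.desc_tmul {A B C : CahiersAlg} (f : A ⟶ C) (g : B ⟶ C) (a : A.obj)
    (b : B.obj) : (CahiersAlg.desc f g).hom.hom (a ⊗ₜ[ℝ] b) = f.hom.hom a * g.hom.hom b :=
  Algebra.TensorProduct.lift_tmul f.hom.hom g.hom.hom (fun _ _ => .all _ _) a b

@[simp]
theorem CahiersAlg.inl_desc {A B C : CahiersAlg} (f : A ⟶ C) (g : B ⟶ C) :
    A.inl B ≫ CahiersAlg.desc f g = f :=
  CahiersAlg.hom_ext (Algebra.TensorProduct.lift_comp_includeLeft _ _ fun _ _ => .all _ _)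

@[simp]
theorem CahiersAlg.inr_desc {A B C : CahiersAlg} (f : A ⟶ C) (g : B ⟶ C) :
    A.inr B ≫ CahiersAlg.desc f g = g :=
  CahiersAlg.hom_ext (Algebra.TensorProduct.lift_comp_includeRight _ _ fun _ _ => .all _ _)

/-- The homomorphism `ℝ[X] ⟶ A` with value `a` at `X`. -/
def evalAt {A : CahiersAlg} (a : A.obj) : polyX ⟶ A :=
  cHom (Polynomial.aeval a)

@[simp]
theorem evalAt_X {A : CahiersAlg} (a : A.obj) :
    (evalAt a).hom.hom (Polynomial.X : Polynomial ℝ) = a :=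
  Polynomial.aeval_X a

theorem polyX_hom_ext {A : CahiersAlg} {f g : polyX ⟶ A}
    (h : f.hom.hom (Polynomial.X : Polynomial ℝ) = g.hom.hom (Polynomial.X : Polynomial ℝ)) :
    f = g :=
  CahiersAlg.hom_ext (Polynomial.algHom_ext h)

theorem exists_evalAt_eq {A : CahiersAlg} (f : polyX ⟶ A) : ∃ a : A.obj, f = evalAt a :=
  ⟨f.hom.hom (Polynomial.X : Polynomial ℝ), polyX_hom_ext (evalAt_X _).symm⟩

theorem w1_hom_ext {A : CahiersAlg} {f g : weilToCahiers.obj w1 ⟶ A}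
    (h : f.hom.hom Alg1.x = g.hom.hom Alg1.x) : f = g :=
  CahiersAlg.hom_ext (Alg1.hom_ext h)

theorem w2_hom_ext {A : CahiersAlg} {f g : weilToCahiers.obj w2 ⟶ A}
    (hx : f.hom.hom Alg2.x = g.hom.hom Alg2.x) (hy : f.hom.hom Alg2.y = g.hom.hom Alg2.y) :
    f = g :=
  CahiersAlg.hom_ext (Alg2.hom_ext hx hy)

/-- Homomorphisms out of ℝ[X] are elements of the target, and the cooperations were chosen to induce
the ring operations on them. -/
theorem coadd_desc {A : CahiersAlg} (a b : A.obj) :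
    coadd ≫ CahiersAlg.desc (evalAt a) (evalAt b) = evalAt (a + b) := by
  refine polyX_hom_ext ?_
  have h : coadd.hom.hom (Polynomial.X : Polynomial ℝ) =
    (Polynomial.X : Polynomial ℝ) ⊗ₜ[ℝ] (1 : Polynomial ℝ) +
      (1 : Polynomial ℝ) ⊗ₜ[ℝ] (Polynomial.X : Polynomial ℝ) := Polynomial.aeval_X _
  change (CahiersAlg.desc (evalAt a) (evalAt b)).hom.hom (coadd.hom.hom _) = _
  rw [h, map_add, CahiersAlg.desc_tmul, CahiersAlg.desc_tmul, evalAt_X, evalAt_X, evalAt_X,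
    map_one, map_one, mul_one, one_mul]

theorem comul_desc {A : CahiersAlg} (a b : A.obj) :
    comul ≫ CahiersAlg.desc (evalAt a) (evalAt b) = evalAt (a * b) := by
  refine polyX_hom_ext ?_
  have h : comul.hom.hom (Polynomial.X : Polynomial ℝ) =
    (Polynomial.X : Polynomial ℝ) ⊗ₜ[ℝ] (Polynomial.X : Polynomial ℝ) := Polynomial.aeval_X _
  change (CahiersAlg.desc (evalAt a) (evalAt b)).hom.hom (comul.hom.hom _) = _
  rw [h, CahiersAlg.desc_tmul, evalAt_X, evalAt_X, evalAt_X]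

/-! ### Scaling homomorphisms with coefficients in a cahiers algebra -/

theorem tmul_sq_eq_zero {R A : Type} [CommRing R] [Algebra ℝ R] [CommRing A] [Algebra ℝ A] {z : R}
    (h : z ^ 2 = 0) (a : A) : (z ⊗ₜ[ℝ] a) ^ 2 = 0 := by
  rw [Algebra.TensorProduct.tmul_pow, h, TensorProduct.zero_tmul]

theorem tmul_mul_tmul_eq_zero {R A : Type} [CommRing R] [Algebra ℝ R] [CommRing A] [Algebra ℝ A]
    {z w : R} (h : z * w = 0) (a b : A) : (z ⊗ₜ[ℝ] a) * (w ⊗ₜ[ℝ] b) = 0 := by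
  rw [Algebra.TensorProduct.tmul_mul_tmul, h, TensorProduct.zero_tmul]

theorem add_sq_eq_zero_of_mul_eq_zero {R : Type} [CommRing R] {z w : R} (hz : z ^ 2 = 0)
    (hw : w ^ 2 = 0) (h : z * w = 0) : (z + w) ^ 2 = 0 := by
  linear_combination hz + hw + 2 * h

theorem tmul_add_tmul_sq_eq_zero {A : Type} [CommRing A] [Algebra ℝ A] (a b : A) :
    (Alg2.x ⊗ₜ[ℝ] a + Alg2.y ⊗ₜ[ℝ] b) ^ 2 = 0 :=
  add_sq_eq_zero_of_mul_eq_zero (tmul_sq_eq_zero Alg2.x_sq a) (tmul_sq_eq_zero Alg2.y_sq b)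
    (tmul_mul_tmul_eq_zero Alg2.x_mul_y a b)

/-- `ℝ[X]/(X²) ⟶ ℝ[X]/(X²) ⊗ A`, `X ↦ a X`. -/
def scaleBy {A : CahiersAlg} (a : A.obj) :
    weilToCahiers.obj w1 ⟶ (weilToCahiers.obj w1).tensor A :=
  cHom (Alg1.lift (Alg1.x ⊗ₜ[ℝ] a : Alg1 ⊗[ℝ] A.obj)
    (tmul_sq_eq_zero Alg1.x_sq a))

/-- `ℝ[X,Y]/(X²,Y²,XY) ⟶ ℝ[X,Y]/(X²,Y²,XY) ⊗ A`, `X ↦ a X`, `Y ↦ a Y`. -/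
def scaleBy₂ {A : CahiersAlg} (a : A.obj) :
    weilToCahiers.obj w2 ⟶ (weilToCahiers.obj w2).tensor A :=
  cHom (Alg2.lift (Alg2.x ⊗ₜ[ℝ] a : Alg2 ⊗[ℝ] A.obj) (Alg2.y ⊗ₜ[ℝ] a : Alg2 ⊗[ℝ] A.obj)
    (tmul_sq_eq_zero Alg2.x_sq a) (tmul_sq_eq_zero Alg2.y_sq a)
    (tmul_mul_tmul_eq_zero Alg2.x_mul_y a a))

/-- `ℝ[X]/(X²) ⟶ ℝ[X,Y]/(X²,Y²,XY) ⊗ A`, `X ↦ a X + b Y`. -/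
def combine {A : CahiersAlg} (a b : A.obj) :
    weilToCahiers.obj w1 ⟶ (weilToCahiers.obj w2).tensor A :=
  cHom (Alg1.lift (Alg2.x ⊗ₜ[ℝ] a + Alg2.y ⊗ₜ[ℝ] b : Alg2 ⊗[ℝ] A.obj)
    (tmul_add_tmul_sq_eq_zero a b))

section

variable {A : CahiersAlg}

theorem scaleBy_x (a : A.obj) : (scaleBy a).hom.hom Alg1.x = Alg1.x ⊗ₜ[ℝ] a :=
  Alg1.lift_x _ (tmul_sq_eq_zero Alg1.x_sq a)

theorem scaleBy₂_x (a : A.obj) : (scaleBy₂ a).hom.hom Alg2.x = Alg2.x ⊗ₜ[ℝ] a :=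
  Alg2.lift_x _ _ (tmul_sq_eq_zero Alg2.x_sq a) (tmul_sq_eq_zero Alg2.y_sq a)
    (tmul_mul_tmul_eq_zero Alg2.x_mul_y a a)

theorem scaleBy₂_y (a : A.obj) : (scaleBy₂ a).hom.hom Alg2.y = Alg2.y ⊗ₜ[ℝ] a :=
  Alg2.lift_y _ _ (tmul_sq_eq_zero Alg2.x_sq a) (tmul_sq_eq_zero Alg2.y_sq a)
    (tmul_mul_tmul_eq_zero Alg2.x_mul_y a a)

theorem combine_x (a b : A.obj) :
    (combine a b).hom.hom Alg1.x = Alg2.x ⊗ₜ[ℝ] a + Alg2.y ⊗ₜ[ℝ] b :=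
  Alg1.lift_x _ (tmul_add_tmul_sq_eq_zero a b)

theorem scaleBy_one :
    scaleBy (1 : A.obj) = weilToCahiers.map (𝟙 w1) ≫ (weilToCahiers.obj w1).inl A :=
  w1_hom_ext (scaleBy_x 1)

theorem scaleBy_desc {W : WeilAlg} (a : A.obj)
    (h : weilToCahiers.obj w1 ⟶ (weilToCahiers.obj W).tensor A) (z : W.obj) (b : A.obj)
    (hh : h.hom.hom Alg1.x = z ⊗ₜ[ℝ] b) :
    (scaleBy a ≫ CahiersAlg.desc h ((weilToCahiers.obj W).inr A)).hom.hom Alg1.x =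
      z ⊗ₜ[ℝ] (b * a) := by
  change (CahiersAlg.desc _ _).hom.hom ((scaleBy a).hom.hom Alg1.x) = _
  rw [scaleBy_x, CahiersAlg.desc_tmul]
  refine (congrArg (· * _) hh).trans ?_
  exact (Algebra.TensorProduct.tmul_mul_tmul ..).trans (by rw [mul_one])

/-- Copairing with `inr` extends a homomorphism `V ⟶ W ⊗ A` to be `A`-linear on `V ⊗ A`. The
composite is thus composition of maps with coefficients in `A`, and the scaling factors multiply. -/
theorem scaleBy_mul (a b : A.obj) :
    scaleBy b ≫ CahiersAlg.desc (scaleBy a) ((weilToCahiers.obj w1).inr A) = scaleBy (a * b) :=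
  w1_hom_ext ((scaleBy_desc b (scaleBy a) _ _ (scaleBy_x a)).trans (scaleBy_x _).symm)

/-- The extension of scalars of a homomorphism of Weil algebras along `ℝ ⟶ A`. -/
abbrev extend {V W : WeilAlg} (f : V ⟶ W) (A : CahiersAlg) :
    weilToCahiers.obj V ⟶ (weilToCahiers.obj W).tensor A :=
  weilToCahiers.map f ≫ (weilToCahiers.obj W).inl A

theorem desc_extend_tmul {V W : WeilAlg} (f : V ⟶ W) (v : V.obj) (a : A.obj) :
    (CahiersAlg.desc (extend f A) ((weilToCahiers.obj W).inr A)).hom.hom (v ⊗ₜ[ℝ] a) =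
      f.hom.hom v ⊗ₜ[ℝ] a :=
  (CahiersAlg.desc_tmul ..).trans
    ((Algebra.TensorProduct.tmul_mul_tmul ..).trans (by rw [mul_one, one_mul]; rfl))

/-- Both sides kill `X`. This is why scaling a tangent vector keeps its base point. -/
theorem scaleBy_aug (a : A.obj) :
    scaleBy a ≫ CahiersAlg.desc (extend aug1 A) ((weilToCahiers.obj wR).inr A) =
      extend aug1 A := by
  refine w1_hom_ext ?_
  have h : aug1.hom.hom Alg1.x = 0 := Alg1.lift_x _ (by simp)
  change (CahiersAlg.desc _ _).hom.hom ((scaleBy a).hom.hom Alg1.x) =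
    (show ((weilToCahiers.obj wR).tensor A).obj from (aug1.hom.hom Alg1.x) ⊗ₜ[ℝ] (1 : A.obj))
  rw [scaleBy_x, desc_extend_tmul, h, TensorProduct.zero_tmul, TensorProduct.zero_tmul]

theorem proj1_x : proj1.hom.hom Alg2.x = Alg1.x :=
  Alg2.lift_x _ _ Alg1.x_sq (by simp) (by simp)

theorem proj1_y : proj1.hom.hom Alg2.y = 0 :=
  Alg2.lift_y _ _ Alg1.x_sq (by simp) (by simp)

theorem proj2_x : proj2.hom.hom Alg2.x = 0 :=
  Alg2.lift_x _ _ (by simp) Alg1.x_sq (by simp)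

theorem proj2_y : proj2.hom.hom Alg2.y = Alg1.x :=
  Alg2.lift_y _ _ (by simp) Alg1.x_sq (by simp)

theorem fold_x : fold.hom.hom Alg2.x = Alg1.x :=
  Alg2.lift_x _ _ Alg1.x_sq Alg1.x_sq (by rw [← sq, Alg1.x_sq])

theorem fold_y : fold.hom.hom Alg2.y = Alg1.x :=
  Alg2.lift_y _ _ Alg1.x_sq Alg1.x_sq (by rw [← sq, Alg1.x_sq])

/-- Scaling commutes with the homomorphisms that are linear in the generators. -/
theorem scaleBy₂_extend (f : w2 ⟶ w1) (r s : ℝ) (hx : f.hom.hom Alg2.x = r • Alg1.x)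
    (hy : f.hom.hom Alg2.y = s • Alg1.x) (a : A.obj) :
    scaleBy₂ a ≫ CahiersAlg.desc (extend f A) ((weilToCahiers.obj w1).inr A) =
      weilToCahiers.map f ≫ scaleBy a := by
  refine w2_hom_ext ?_ ?_
  · change (CahiersAlg.desc _ _).hom.hom ((scaleBy₂ a).hom.hom Alg2.x) =
      (scaleBy a).hom.hom (f.hom.hom Alg2.x)
    rw [scaleBy₂_x, desc_extend_tmul, hx, map_smul, scaleBy_x, TensorProduct.smul_tmul']
  · change (CahiersAlg.desc _ _).hom.hom ((scaleBy₂ a).hom.hom Alg2.y) =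
      (scaleBy a).hom.hom (f.hom.hom Alg2.y)
    rw [scaleBy₂_y, desc_extend_tmul, hy, map_smul, scaleBy_x, TensorProduct.smul_tmul']

/-- For `(r, s) = (1, 0), (0, 1), (1, 1)`, that is for `proj1`, `proj2` and `fold`, the scaling
factors are `a`, `b` and `a + b`. -/
theorem combine_extend (f : w2 ⟶ w1) (r s : ℝ) (hx : f.hom.hom Alg2.x = r • Alg1.x)
    (hy : f.hom.hom Alg2.y = s • Alg1.x) (a b : A.obj) :
    combine a b ≫ CahiersAlg.desc (extend f A) ((weilToCahiers.obj w1).inr A) =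
      scaleBy (r • a + s • b) := by
  refine w1_hom_ext ?_
  change (CahiersAlg.desc _ _).hom.hom ((combine a b).hom.hom Alg1.x) = _
  rw [combine_x, map_add, desc_extend_tmul, desc_extend_tmul, hx, hy, scaleBy_x,
    TensorProduct.tmul_add, TensorProduct.tmul_smul, TensorProduct.tmul_smul,
    TensorProduct.smul_tmul', TensorProduct.smul_tmul']

end

/-! ### Points of the line object -/

variable {K : Type u} [Category.{v} K] (D : CahiersAlgᵒᵖ ⥤ K)

section Line

variable {T : K} {A B C : CahiersAlg}

/-- The generalized element of the line object given by an element of a cahiers algebra. -/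
def elt (α : T ⟶ D.obj (op A)) (a : A.obj) : T ⟶ line D := α ≫ D.map (evalAt a).op

/-- Negation on the line object. -/
def lineNeg : line D ⟶ line D := elt D (𝟙 _) (-Polynomial.X : Polynomial ℝ)

theorem elt_lineNeg (α : T ⟶ D.obj (op A)) (a : A.obj) :
    elt D α a ≫ lineNeg D = elt D α (-a) := by
  rw [lineNeg, elt, elt, Category.id_comp, Category.assoc, ← D.map_comp, ← op_comp, elt]
  congr 3
  refine polyX_hom_ext ?_
  change (evalAt a).hom.hom ((evalAt _).hom.hom _) = _
  rw [evalAt_X, evalAt_X, map_neg, evalAt_X]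

variable [CartesianMonoidalCategory K] [PreservesFiniteProducts D]

theorem prodIso_hom_fst : (prodIso D A B).hom ≫ fst _ _ = D.map (A.inl B).op :=
  lift_fst _ _

theorem prodIso_hom_snd : (prodIso D A B).hom ≫ snd _ _ = D.map (A.inr B).op :=
  lift_snd _ _

theorem prodIso_inv_inl : (prodIso D A B).inv ≫ D.map (A.inl B).op = fst _ _ := by
  rw [Iso.inv_comp_eq, prodIso_hom_fst]

theorem prodIso_inv_inl_assoc {Z : K} (h : D.obj (op A) ⟶ Z) :
    (prodIso D A B).inv ≫ D.map (A.inl B).op ≫ h = fst _ _ ≫ h := by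
  rw [← Category.assoc, prodIso_inv_inl]

theorem prodIso_inv_inr : (prodIso D A B).inv ≫ D.map (A.inr B).op = snd _ _ := by
  rw [Iso.inv_comp_eq, prodIso_hom_snd]

theorem prodIso_inv_inr_assoc {Z : K} (h : D.obj (op B) ⟶ Z) :
    (prodIso D A B).inv ≫ D.map (A.inr B).op ≫ h = snd _ _ ≫ h := by
  rw [← Category.assoc, prodIso_inv_inr]

/-- Points induced from a common `α` are paired by the copairing of algebras; this is what moves
computations from `K` to algebras. -/
theorem lift_prodIso_inv (α : T ⟶ D.obj (op C)) (f : A ⟶ C) (g : B ⟶ C) :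
    lift (α ≫ D.map f.op) (α ≫ D.map g.op) ≫ (prodIso D A B).inv =
      α ≫ D.map (CahiersAlg.desc f g).op := by
  rw [Iso.comp_inv_eq]
  ext
  · rw [lift_fst, Category.assoc, Category.assoc, prodIso_hom_fst, ← D.map_comp, ← op_comp,
      CahiersAlg.inl_desc]
  · rw [lift_snd, Category.assoc, Category.assoc, prodIso_hom_snd, ← D.map_comp, ← op_comp,
      CahiersAlg.inr_desc]

theorem lift_prodIso_inv_assoc (α : T ⟶ D.obj (op C)) (f : A ⟶ C) (g : B ⟶ C) {Z : K}
    (h : D.obj (op (A.tensor B)) ⟶ Z) :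
    lift (α ≫ D.map f.op) (α ≫ D.map g.op) ≫ (prodIso D A B).inv ≫ h =
      α ≫ D.map (CahiersAlg.desc f g).op ≫ h := by
  rw [← Category.assoc, lift_prodIso_inv, Category.assoc]

/-- The triple is itself a point of `D(ℝ[X] ⊗ ℝ[X] ⊗ ℝ[X])`, and the three generators are the
required elements. -/
theorem exists_elt₃ (x y z : T ⟶ line D) : ∃ (A : CahiersAlg) (α : T ⟶ D.obj (op A))
    (a b c : A.obj), x = elt D α a ∧ y = elt D α b ∧ z = elt D α c := by
  let B := polyX.tensor polyX
  obtain ⟨a, ha⟩ := exists_evalAt_eq (polyX.inl B)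
  obtain ⟨b, hb⟩ := exists_evalAt_eq (polyX.inl polyX ≫ polyX.inr B)
  obtain ⟨c, hc⟩ := exists_evalAt_eq (polyX.inr polyX ≫ polyX.inr B)
  refine ⟨polyX.tensor B, lift x (lift y z ≫ (prodIso D _ _).inv) ≫ (prodIso D _ _).inv,
    a, b, c, ?_, ?_, ?_⟩
  · rw [elt, ← ha, Category.assoc, prodIso_inv_inl, lift_fst]
  · rw [elt, ← hb, op_comp, D.map_comp, Category.assoc, prodIso_inv_inr_assoc, lift_snd_assoc,
      Category.assoc, prodIso_inv_inl, lift_fst]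
  · rw [elt, ← hc, op_comp, D.map_comp, Category.assoc, prodIso_inv_inr_assoc, lift_snd_assoc,
      Category.assoc, prodIso_inv_inr, lift_snd]

theorem exists_elt₁ {T : K} (x : T ⟶ line D) :
    ∃ (A : CahiersAlg) (α : T ⟶ D.obj (op A)) (a : A.obj), x = elt D α a := by
  obtain ⟨A, α, a, _, _, h, _, _⟩ := exists_elt₃ D x x x
  exact ⟨A, α, a, h⟩

theorem exists_elt₂ {T : K} (x y : T ⟶ line D) :
    ∃ (A : CahiersAlg) (α : T ⟶ D.obj (op A)) (a b : A.obj),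
      x = elt D α a ∧ y = elt D α b := by
  obtain ⟨A, α, a, b, _, h, h', _⟩ := exists_elt₃ D x y x
  exact ⟨A, α, a, b, h, h'⟩

theorem lift_lineAdd (α : T ⟶ D.obj (op A)) (a b : A.obj) :
    lift (elt D α a) (elt D α b) ≫ lineAdd D = elt D α (a + b) := by
  rw [elt, elt, lineAdd, lift_prodIso_inv_assoc, ← D.map_comp, ← op_comp, coadd_desc, elt]

theorem lift_lineMul (α : T ⟶ D.obj (op A)) (a b : A.obj) :
    lift (elt D α a) (elt D α b) ≫ lineMul D = elt D α (a * b) := by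
  rw [elt, elt, lineMul, lift_prodIso_inv_assoc, ← D.map_comp, ← op_comp, comul_desc, elt]

/-- A real number as a point of the line object. -/
def lineConst (r : ℝ) : 𝟙_ K ⟶ line D :=
  elt D (unitIso D).hom (show (weilToCahiers.obj wR).obj from r)

/-- `D(ℝ)` is terminal, so a constant point may be rewritten along any `α`, whichever algebra the
other points use. -/
theorem toUnit_lineConst (α : T ⟶ D.obj (op A)) (r : ℝ) :
    toUnit T ≫ lineConst D r = elt D α (algebraMap ℝ A.obj r) := by
  have h : toUnit T ≫ (unitIso D).hom = α ≫ D.map (isInitialReal.to A).op :=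
    (isTerminalReal D).hom_ext _ _
  rw [lineConst, elt, reassoc_of% h, ← D.map_comp, ← op_comp, elt]
  congr 3
  refine polyX_hom_ext ?_
  change (isInitialReal.to A).hom.hom ((evalAt _).hom.hom _) = _
  rw [evalAt_X, evalAt_X]
  rfl

end Line

/-! ### The action of parametrized homomorphisms on prolongations -/

section Prolongation

variable [CartesianMonoidalCategory K] [MonoidalClosed K]

theorem uncurry_comp_prolong_map {M T : K} {V W : WeilAlg} (f : V ⟶ W)
    (v : T ⟶ (prolong D M).obj V) :
    MonoidalClosed.uncurry (A := D.obj (op (weilToCahiers.obj W))) (v ≫ (prolong D M).map f) =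
      D.map (weilToCahiers.map f).op ▷ T ≫
        MonoidalClosed.uncurry (A := D.obj (op (weilToCahiers.obj V))) v :=
  MonoidalClosed.uncurry_pre_app (A := D.obj (op (weilToCahiers.obj V))) (X := M) (f := v)
    (D.map (weilToCahiers.map f).op)

variable [PreservesFiniteProducts D] {M T : K} {A : CahiersAlg} {U V W : WeilAlg}

/-- For `t ∈ D(A)`, a homomorphism `g : V ⟶ W ⊗ A` gives a map `D(W) ⟶ D(V)`, and hence a map
`M^{D(V)} ⟶ M^{D(W)}`. -/
def act (α : T ⟶ D.obj (op A)) (g : weilToCahiers.obj V ⟶ (weilToCahiers.obj W).tensor A)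
    (v : T ⟶ (prolong D M).obj V) : T ⟶ (prolong D M).obj W :=
  MonoidalClosed.curry (A := D.obj (op (weilToCahiers.obj W)))
    (lift (lift (fst _ _) (snd _ _ ≫ α) ≫ (prodIso D _ _).inv ≫ D.map g.op) (snd _ _) ≫
      MonoidalClosed.uncurry (A := D.obj (op (weilToCahiers.obj V))) v)

theorem uncurry_act (α : T ⟶ D.obj (op A))
    (g : weilToCahiers.obj V ⟶ (weilToCahiers.obj W).tensor A) (v : T ⟶ (prolong D M).obj V) :
    MonoidalClosed.uncurry (A := D.obj (op (weilToCahiers.obj W))) (act D α g v) =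
      lift (lift (fst _ _) (snd _ _ ≫ α) ≫ (prodIso D _ _).inv ≫ D.map g.op) (snd _ _) ≫
        MonoidalClosed.uncurry (A := D.obj (op (weilToCahiers.obj V))) v :=
  MonoidalClosed.uncurry_curry _

/-- A homomorphism without coefficients in `A` ignores the parameter, so only functoriality of the
prolongation remains. -/
theorem act_extend (α : T ⟶ D.obj (op A)) (f : V ⟶ W) (v : T ⟶ (prolong D M).obj V) :
    act D α (extend f A) v = v ≫ (prolong D M).map f := by
  refine MonoidalClosed.uncurry_injective (A := D.obj (op (weilToCahiers.obj W))) ?_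
  refine (uncurry_act D α _ v).trans ((uncurry_comp_prolong_map D f v).trans ?_).symm
  congr 1
  ext
  · rw [whiskerRight_fst, lift_fst, op_comp, D.map_comp, prodIso_inv_inl_assoc, lift_fst_assoc]
  · rw [whiskerRight_snd, lift_snd]

/-- Both homomorphisms use the same parameter `t ∈ D(A)`; the copairing with `inr` passes it on to
the second use. -/
theorem act_act (α : T ⟶ D.obj (op A)) (g : weilToCahiers.obj U ⟶ (weilToCahiers.obj V).tensor A)
    (h : weilToCahiers.obj V ⟶ (weilToCahiers.obj W).tensor A) (v : T ⟶ (prolong D M).obj U) :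
    act D α h (act D α g v) =
      act D α (g ≫ CahiersAlg.desc h ((weilToCahiers.obj W).inr A)) v := by
  refine MonoidalClosed.uncurry_injective (A := D.obj (op (weilToCahiers.obj W))) ?_
  refine (uncurry_act D α _ _).trans (Eq.trans ?_ (uncurry_act D α _ v).symm)
  rw [uncurry_act, ← Category.assoc]
  congr 1
  ext
  · rw [Category.assoc, lift_fst, comp_lift_assoc, lift_fst, lift_snd_assoc, lift_fst, op_comp,
      D.map_comp]
    -- On a pair `(d, t)`, the copairing applies `h` to it and returns `t` unchanged as the other
    -- component.
    have h1 := lift_prodIso_inv D (lift (fst (D.obj (op (weilToCahiers.obj W))) T)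
      (snd _ _ ≫ α) ≫ (prodIso D _ _).inv) h ((weilToCahiers.obj W).inr A)
    rw [Category.assoc, Category.assoc, Category.assoc, prodIso_inv_inr, lift_snd] at h1
    rw [reassoc_of% h1]
  · rw [Category.assoc, lift_snd, lift_snd, lift_snd]

theorem lift_scalar (α : T ⟶ D.obj (op A)) (a : A.obj) (v : T ⟶ (prolong D M).obj w1) :
    lift (elt D α a) v ≫ scalar D M = act D α (scaleBy a) v := by
  refine MonoidalClosed.uncurry_injective (A := dObj D) ?_
  refine Eq.trans ?_ (uncurry_act D α _ v).symm
  refine (MonoidalClosed.uncurry_natural_left (A := dObj D) _ _).trans ?_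
  refine (congrArg (dObj D ◁ lift (elt D α a) v ≫ ·)
    (MonoidalClosed.uncurry_curry (A := dObj D) _)).trans ?_
  refine Eq.trans ?_ (congrArg (_ ≫ ·) (MonoidalClosed.uncurry_eq (A := dObj D) v)).symm
  -- The point `d · a(t)` is the image of `(d, t)` under `D(scaleBy a)`: `coact` sends `X` to `X ⊗
  -- X`, whose second factor is then evaluated at `a`.
  have h : lift (fst (dObj D) T) (snd _ _ ≫ elt D α a) ≫ dAct D =
      lift (fst _ _) (snd _ _ ≫ α) ≫ (prodIso D _ _).inv ≫ D.map (scaleBy a).op := by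
    have h1 := lift_prodIso_inv D (lift (fst (dObj D) T) (snd _ _ ≫ α) ≫ (prodIso D _ _).inv)
      ((weilToCahiers.obj w1).inl A) (evalAt a ≫ (weilToCahiers.obj w1).inr A)
    rw [op_comp, D.map_comp, Category.assoc, Category.assoc, Category.assoc, prodIso_inv_inl,
      prodIso_inv_inr_assoc, lift_fst, lift_snd_assoc, Category.assoc] at h1
    rw [dAct, elt, reassoc_of% h1, ← D.map_comp, ← op_comp]
    congr 4
    refine w1_hom_ext ?_
    have h2 : coact.hom.hom Alg1.x = Alg1.x ⊗ₜ[ℝ] (Polynomial.X : Polynomial ℝ) :=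
      Alg1.lift_x _ (tmul_sq_eq_zero Alg1.x_sq _)
    change (CahiersAlg.desc _ _).hom.hom (coact.hom.hom Alg1.x) = _
    rw [h2, CahiersAlg.desc_tmul, scaleBy_x]
    refine (congrArg (fun t => _ * ((weilToCahiers.obj w1).inr A).hom.hom t) (evalAt_X a)).trans ?_
    exact (Algebra.TensorProduct.tmul_mul_tmul ..).trans (by rw [mul_one, one_mul])
  -- Reassociation: `(d, (r, v))` is sent to `(d · r, v)` before evaluation.
  have h' : dObj D ◁ lift (elt D α a) v ≫ (α_ _ _ _).inv ≫ dAct D ▷ _ =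
      lift (lift (fst (dObj D) T) (snd _ _ ≫ elt D α a) ≫ dAct D) (snd _ _) ≫ dObj D ◁ v := by
    ext
    · have h1 : dObj D ◁ lift (elt D α a) v ≫ (α_ (dObj D) (line D) _).inv ≫ fst _ _ =
          lift (fst (dObj D) T) (snd _ _ ≫ elt D α a) := by
        ext <;> simp
      rw [← h1]
      simp
    · simp
  rw [← h]
  refine Eq.trans ?_ ((congrArg (· ≫ (ihom.ev (dObj D)).app M) h').trans (Category.assoc _ _ _))
  exact ((Category.assoc _ _ _).trans (congrArg (_ ≫ ·) (Category.assoc _ _ _))).symm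

end Prolongation

end WeilCat

end

noncomputable section

namespace WeilCat

/-! ### Checking identities on generalized elements -/

section Points

variable {C : Type u} [Category.{v} C] [CartesianMonoidalCategory C] {R V : C}

/-- Yoneda: the law is tested on the identity of `V`. The lemmas that follow test on projections of
products in the same way. -/
theorem whiskerRight_comp_of_points {o : 𝟙_ C ⟶ R} {s : R ⊗ V ⟶ V}
    (h : ∀ {T : C} (z : T ⟶ V), lift (toUnit T ≫ o) z ≫ s = z) : o ▷ V ≫ s = (λ_ V).hom := by
  rw [← cancel_epi (λ_ V).inv, Iso.inv_hom_id, ← h (𝟙 V), ← Category.assoc]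
  congr 1
  ext <;> simp

theorem whiskerLeft_comp_of_points {o : 𝟙_ C ⟶ R} {s : V ⊗ R ⟶ V}
    (h : ∀ {T : C} (z : T ⟶ V), lift z (toUnit T ≫ o) ≫ s = z) : V ◁ o ≫ s = (ρ_ V).hom := by
  rw [← cancel_epi (ρ_ V).inv, Iso.inv_hom_id, ← h (𝟙 V), ← Category.assoc]
  congr 1
  ext <;> simp

/-- Allowing `V` to differ from `R` covers associativity of a ring operation and of an action
together; the distributive laws below have two uses likewise. -/
theorem assoc_of_points {m : R ⊗ R ⟶ R} {s : R ⊗ V ⟶ V}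
    (h : ∀ {T : C} (x y : T ⟶ R) (z : T ⟶ V),
      lift (lift x y ≫ m) z ≫ s = lift x (lift y z ≫ s) ≫ s) :
    m ▷ V ≫ s = (α_ R R V).hom ≫ R ◁ s ≫ s := by
  have h1 := h (fst (R ⊗ R) V ≫ fst R R) (fst (R ⊗ R) V ≫ snd R R) (snd (R ⊗ R) V)
  rw [← lift_whiskerRight_assoc, ← lift_whiskerLeft_assoc, ← lift_lift_associator_hom_assoc] at h1
  have h2 : lift (lift (fst (R ⊗ R) V ≫ fst R R) (fst (R ⊗ R) V ≫ snd R R)) (snd (R ⊗ R) V) =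
      𝟙 _ := by
    ext <;> simp
  rwa [h2, Category.id_comp, Category.id_comp] at h1

theorem smul_add_of_points {p : V ⊗ V ⟶ V} {s : R ⊗ V ⟶ V}
    (h : ∀ {T : C} (x : T ⟶ R) (y z : T ⟶ V),
      lift x (lift y z ≫ p) ≫ s = lift (lift x y ≫ s) (lift x z ≫ s) ≫ p) :
    R ◁ p ≫ s = lift (R ◁ fst V V ≫ s) (R ◁ snd V V ≫ s) ≫ p := by
  have h1 := h (fst R (V ⊗ V)) (snd R (V ⊗ V) ≫ fst V V) (snd R (V ⊗ V) ≫ snd V V)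
  have h2 : lift (fst R (V ⊗ V))
      (lift (snd R (V ⊗ V) ≫ fst V V) (snd R (V ⊗ V) ≫ snd V V) ≫ p) = R ◁ p := by
    ext <;> simp
  have h3 : lift (fst R (V ⊗ V)) (snd R (V ⊗ V) ≫ fst V V) = R ◁ fst V V := by
    ext <;> simp
  have h4 : lift (fst R (V ⊗ V)) (snd R (V ⊗ V) ≫ snd V V) = R ◁ snd V V := by
    ext <;> simp
  rwa [h2, h3, h4] at h1

theorem add_smul_of_points {q : R ⊗ R ⟶ R} {p : V ⊗ V ⟶ V} {s : R ⊗ V ⟶ V}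
    (h : ∀ {T : C} (x y : T ⟶ R) (z : T ⟶ V),
      lift (lift x y ≫ q) z ≫ s = lift (lift x z ≫ s) (lift y z ≫ s) ≫ p) :
    q ▷ V ≫ s = lift (fst R R ▷ V ≫ s) (snd R R ▷ V ≫ s) ≫ p := by
  have h1 := h (fst (R ⊗ R) V ≫ fst R R) (fst (R ⊗ R) V ≫ snd R R) (snd (R ⊗ R) V)
  have h2 : lift (lift (fst (R ⊗ R) V ≫ fst R R) (fst (R ⊗ R) V ≫ snd R R) ≫ q)
      (snd (R ⊗ R) V) = q ▷ V := by
    ext <;> simp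
  have h3 : lift (fst (R ⊗ R) V ≫ fst R R) (snd (R ⊗ R) V) = fst R R ▷ V := by
    ext <;> simp
  have h4 : lift (fst (R ⊗ R) V ≫ snd R R) (snd (R ⊗ R) V) = snd R R ▷ V := by
    ext <;> simp
  rwa [h2, h3, h4] at h1

theorem braiding_comp_of_points [BraidedCategory C] {m : R ⊗ R ⟶ V}
    (h : ∀ {T : C} (x y : T ⟶ R), lift x y ≫ m = lift y x ≫ m) : (β_ R R).hom ≫ m = m := by
  have h1 := h (snd R R) (fst R R)
  rwa [lift_snd_fst, lift_fst_snd, Category.id_comp] at h1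

end Points

section Slice

variable {C : Type u} [Category.{v} C] [HasPullbacks C] {M : C}

theorem lift_left_fst_left {T X Y : Over M} (f : T ⟶ X) (g : T ⟶ Y) :
    (lift f g).left ≫ (fst X Y).left = f.left := by
  rw [← Over.comp_left, lift_fst]

theorem lift_left_snd_left {T X Y : Over M} (f : T ⟶ X) (g : T ⟶ Y) :
    (lift f g).left ≫ (snd X Y).left = g.left := by
  rw [← Over.comp_left, lift_snd]

end Slice

variable {K : Type u} [Category.{v} K] [CartesianMonoidalCategory K]
  (D : CahiersAlgᵒᵖ ⥤ K)

/-! ### The ring object `ℝ × M ⟶ M` -/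

section Ring

variable {M : K}

/-- The `M`-component is forced by the structure map to `M`, so laws in the slice reduce to laws of
the line in `K`. -/
theorem lineOver_hom_ext {T : Over M} {f g : T ⟶ lineOver D M}
    (h : f.left ≫ fst (line D) M = g.left ≫ fst (line D) M) : f = g := by
  ext1
  exact CartesianMonoidalCategory.hom_ext _ _ h ((Over.w f).trans (Over.w g).symm)

/-- Negation `(r, m) ↦ (-r, m)` on `ℝ × M ⟶ M`. -/
def fiberwiseNeg (M : K) : lineOver D M ⟶ lineOver D M :=
  Over.homMk (lineNeg D ▷ M) (by simp)

theorem fiberwiseNeg_left_fst {T : Over M} (f : T ⟶ lineOver D M) :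
    (f ≫ fiberwiseNeg D M).left ≫ fst (line D) M = (f.left ≫ fst (line D) M) ≫ lineNeg D := by
  have h : (fiberwiseNeg D M).left ≫ fst (line D) M = fst (line D) M ≫ lineNeg D :=
    whiskerRight_fst _ _
  rw [Over.comp_left, Category.assoc, h, Category.assoc]

variable [HasPullbacks K]

theorem lift_fiberwise_left_fst {T : Over M} (f g : T ⟶ lineOver D M)
    (m : line D ⊗ line D ⟶ line D) :
    (lift f g ≫ fiberwise D M m).left ≫ fst (line D) M =
      lift (f.left ≫ fst (line D) M) (g.left ≫ fst (line D) M) ≫ m := by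
  have h : (fiberwise D M m).left ≫ fst (line D) M =
      lift ((fst (lineOver D M) (lineOver D M)).left ≫ fst (line D) M)
        ((snd (lineOver D M) (lineOver D M)).left ≫ fst (line D) M) ≫ m := lift_fst _ _
  rw [Over.comp_left, Category.assoc, h, comp_lift_assoc, ← Category.assoc,
    lift_left_fst_left, ← Category.assoc, lift_left_snd_left]

/-- The section `m ↦ (c, m)` of `ℝ × M ⟶ M`. -/
def fiberwiseConst (M : K) (c : 𝟙_ K ⟶ line D) : 𝟙_ (Over M) ⟶ lineOver D M :=
  Over.homMk (lift (toUnit M ≫ c) (𝟙 M)) (by simp)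

theorem toUnit_fiberwiseConst_left_fst (T : Over M) (c : 𝟙_ K ⟶ line D) :
    (toUnit T ≫ fiberwiseConst D M c).left ≫ fst (line D) M = toUnit T.left ≫ c := by
  have h : (fiberwiseConst D M c).left ≫ fst (line D) M = toUnit M ≫ c := lift_fst _ _
  rw [Over.comp_left, Category.assoc, h, ← Category.assoc]
  congr 1
  exact toUnit_unique _ _

variable [PreservesFiniteProducts D]

/-! ### Ring laws on points, each read off from a cahiers algebra -/

section

variable {T : Over M} (x y z : T ⟶ lineOver D M)

theorem fiberwise_zero_add :
    lift (toUnit T ≫ fiberwiseConst D M (lineConst D 0)) x ≫ fiberwise D M (lineAdd D) = x := by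
  refine lineOver_hom_ext D ?_
  obtain ⟨A, α, a, ha⟩ := exists_elt₁ D (x.left ≫ fst (line D) M)
  rw [lift_fiberwise_left_fst, toUnit_fiberwiseConst_left_fst, ha, toUnit_lineConst D α,
    lift_lineAdd, map_zero, zero_add]

theorem fiberwise_add_comm :
    lift x y ≫ fiberwise D M (lineAdd D) = lift y x ≫ fiberwise D M (lineAdd D) := by
  refine lineOver_hom_ext D ?_
  obtain ⟨A, α, a, b, ha, hb⟩ := exists_elt₂ D (x.left ≫ fst (line D) M) (y.left ≫ fst (line D) M)
  rw [lift_fiberwise_left_fst, lift_fiberwise_left_fst, ha, hb, lift_lineAdd, lift_lineAdd,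
    add_comm]

theorem fiberwise_add_assoc :
    lift (lift x y ≫ fiberwise D M (lineAdd D)) z ≫ fiberwise D M (lineAdd D) =
      lift x (lift y z ≫ fiberwise D M (lineAdd D)) ≫ fiberwise D M (lineAdd D) := by
  refine lineOver_hom_ext D ?_
  obtain ⟨A, α, a, b, c, ha, hb, hc⟩ := exists_elt₃ D (x.left ≫ fst (line D) M)
    (y.left ≫ fst (line D) M) (z.left ≫ fst (line D) M)
  simp only [lift_fiberwise_left_fst, ha, hb, hc, lift_lineAdd, add_assoc]

theorem fiberwise_add_neg :
    lift x (x ≫ fiberwiseNeg D M) ≫ fiberwise D M (lineAdd D) =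
      toUnit T ≫ fiberwiseConst D M (lineConst D 0) := by
  refine lineOver_hom_ext D ?_
  obtain ⟨A, α, a, ha⟩ := exists_elt₁ D (x.left ≫ fst (line D) M)
  rw [lift_fiberwise_left_fst, toUnit_fiberwiseConst_left_fst, fiberwiseNeg_left_fst, ha,
    toUnit_lineConst D α, elt_lineNeg, lift_lineAdd, map_zero, add_neg_cancel]

theorem fiberwise_one_mul :
    lift (toUnit T ≫ fiberwiseOne D M) x ≫ fiberwise D M (lineMul D) = x := by
  refine lineOver_hom_ext D ?_
  obtain ⟨A, α, a, ha⟩ := exists_elt₁ D (x.left ≫ fst (line D) M)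
  have h : (toUnit T ≫ fiberwiseOne D M).left ≫ fst (line D) M =
    toUnit T.left ≫ lineConst D 1 := toUnit_fiberwiseConst_left_fst D T _
  rw [lift_fiberwise_left_fst, h, ha, toUnit_lineConst D α, lift_lineMul, map_one, one_mul]

theorem fiberwise_mul_comm :
    lift x y ≫ fiberwise D M (lineMul D) = lift y x ≫ fiberwise D M (lineMul D) := by
  refine lineOver_hom_ext D ?_
  obtain ⟨A, α, a, b, ha, hb⟩ := exists_elt₂ D (x.left ≫ fst (line D) M) (y.left ≫ fst (line D) M)
  rw [lift_fiberwise_left_fst, lift_fiberwise_left_fst, ha, hb, lift_lineMul, lift_lineMul,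
    mul_comm]

theorem fiberwise_mul_assoc :
    lift (lift x y ≫ fiberwise D M (lineMul D)) z ≫ fiberwise D M (lineMul D) =
      lift x (lift y z ≫ fiberwise D M (lineMul D)) ≫ fiberwise D M (lineMul D) := by
  refine lineOver_hom_ext D ?_
  obtain ⟨A, α, a, b, c, ha, hb, hc⟩ := exists_elt₃ D (x.left ≫ fst (line D) M)
    (y.left ≫ fst (line D) M) (z.left ≫ fst (line D) M)
  simp only [lift_fiberwise_left_fst, ha, hb, hc, lift_lineMul, mul_assoc]

theorem fiberwise_mul_add :
    lift x (lift y z ≫ fiberwise D M (lineAdd D)) ≫ fiberwise D M (lineMul D) =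
      lift (lift x y ≫ fiberwise D M (lineMul D)) (lift x z ≫ fiberwise D M (lineMul D)) ≫
        fiberwise D M (lineAdd D) := by
  refine lineOver_hom_ext D ?_
  obtain ⟨A, α, a, b, c, ha, hb, hc⟩ := exists_elt₃ D (x.left ≫ fst (line D) M)
    (y.left ≫ fst (line D) M) (z.left ≫ fst (line D) M)
  simp only [lift_fiberwise_left_fst, ha, hb, hc, lift_lineMul, lift_lineAdd, mul_add]

theorem fiberwise_add_mul :
    lift (lift x y ≫ fiberwise D M (lineAdd D)) z ≫ fiberwise D M (lineMul D) =
      lift (lift x z ≫ fiberwise D M (lineMul D)) (lift y z ≫ fiberwise D M (lineMul D)) ≫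
        fiberwise D M (lineAdd D) := by
  refine lineOver_hom_ext D ?_
  obtain ⟨A, α, a, b, c, ha, hb, hc⟩ := exists_elt₃ D (x.left ≫ fst (line D) M)
    (y.left ≫ fst (line D) M) (z.left ≫ fst (line D) M)
  simp only [lift_fiberwise_left_fst, ha, hb, hc, lift_lineMul, lift_lineAdd, add_mul]

end

/-- The commutative ring object `ℝ × M ⟶ M` of the slice over `M`. -/
abbrev lineOverCommRingObj (M : K) : CommRingObj (lineOver D M) where
  zero := fiberwiseConst D M (lineConst D 0)
  add := fiberwise D M (lineAdd D)
  neg := fiberwiseNeg D M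
  one := fiberwiseOne D M
  mul := fiberwise D M (lineMul D)
  zero_add := whiskerRight_comp_of_points fun _ => fiberwise_zero_add ..
  add_zero := whiskerLeft_comp_of_points fun _ =>
    (fiberwise_add_comm ..).trans (fiberwise_zero_add ..)
  add_assoc := assoc_of_points fun _ _ _ => fiberwise_add_assoc ..
  left_neg := (fiberwise_add_comm ..).trans
    ((congrArg (lift (𝟙 _) · ≫ _) (Category.id_comp _).symm).trans (fiberwise_add_neg D (𝟙 _)))
  right_neg :=
    (congrArg (lift (𝟙 _) · ≫ _) (Category.id_comp _).symm).trans (fiberwise_add_neg D (𝟙 _))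
  add_comm := braiding_comp_of_points fun _ _ => fiberwise_add_comm ..
  one_mul := whiskerRight_comp_of_points fun _ => fiberwise_one_mul ..
  mul_one := whiskerLeft_comp_of_points fun _ =>
    (fiberwise_mul_comm ..).trans (fiberwise_one_mul ..)
  mul_assoc := assoc_of_points fun _ _ _ => fiberwise_mul_assoc ..
  mul_add := smul_add_of_points fun _ _ _ => fiberwise_mul_add ..
  add_mul := add_smul_of_points fun _ _ _ => fiberwise_add_mul ..
  mul_comm := braiding_comp_of_points fun _ _ => fiberwise_mul_comm ..

end Ring

end WeilCat

end

noncomputable section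

namespace WeilCat

variable {K : Type u} [Category.{v} K] [CartesianMonoidalCategory K] [MonoidalClosed K]
  {D : CahiersAlgᵒᵖ ⥤ K}

/-! ### Prolongations of a microlinear object -/

/-- A pullback is the limit of a finite diagram, the cospan, so microlinearity applies directly. -/
theorem Microlinear.isPullback {M : K} (hM : Microlinear D M) {P V W U : WeilAlg} {f : P ⟶ V}
    {g : P ⟶ W} {h : V ⟶ U} {k : W ⟶ U} (sq : IsPullback (IsWeilAlg.ι.map f) (IsWeilAlg.ι.map g)
      (IsWeilAlg.ι.map h) (IsWeilAlg.ι.map k)) :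
    IsPullback ((prolong D M).map f) ((prolong D M).map g) ((prolong D M).map h)
      ((prolong D M).map k) := by
  have comm : f ≫ h = g ≫ k := IsWeilAlg.ι.map_injective (by simpa using sq.w)
  obtain ⟨l⟩ := hM WalkingCospan (cospan h k) (PullbackCone.mk f g comm)
    ⟨(isLimitMapConePullbackConeEquiv IsWeilAlg.ι comm).symm sq.isLimit⟩
  exact ⟨⟨by rw [← Functor.map_comp, ← Functor.map_comp, comm]⟩,
    ⟨isLimitMapConePullbackConeEquiv (prolong D M) comm l⟩⟩

variable [PreservesFiniteProducts D]

variable (D) in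
-- Exponentiation by the terminal object `D(ℝ)` is trivial. The inverse sends `m` to the constant
-- map, the transpose of the projection to `M`.
theorem isIso_prolongReal (M : K) : IsIso (prolongReal D M) := by
  let X := D.obj (op (weilToCahiers.obj wR))
  have hX : ∀ T : K, fst X T = snd X T ≫ toUnit T ≫ (unitIso D).hom := fun T =>
    (isTerminalReal D).hom_ext _ _
  have hlift : ∀ T : K, (λ_ T).inv ≫ (unitIso D).hom ▷ T =
      lift (toUnit T ≫ (unitIso D).hom) (𝟙 T) := fun T => by
    ext <;> simp
  refine ⟨MonoidalClosed.curry (A := X) (snd X M), ?_, ?_⟩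
  · refine MonoidalClosed.uncurry_injective (A := X) ?_
    refine (MonoidalClosed.uncurry_natural_left (A := X) _ _).trans ?_
    refine (congrArg (_ ≫ ·) (MonoidalClosed.uncurry_curry (A := X) _)).trans ?_
    refine Eq.trans ?_ (MonoidalClosed.uncurry_id_eq_ev (A := X) M).symm
    rw [whiskerLeft_snd]
    have h1 : snd X ((prolong D M).obj wR) ≫ (λ_ _).inv ≫ (unitIso D).hom ▷ _ = 𝟙 _ := by
      rw [hlift, comp_lift, ← hX, Category.comp_id, lift_fst_snd]
    exact ((Category.assoc _ _ _).trans (congrArg (_ ≫ ·) (Category.assoc _ _ _))).symm.trans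
      ((congrArg (· ≫ (ihom.ev X).app M) h1).trans (Category.id_comp _))
  · have h2 : MonoidalClosed.curry (A := X) (snd X M) ≫ (λ_ _).inv ≫ (unitIso D).hom ▷ _ =
        ((λ_ M).inv ≫ (unitIso D).hom ▷ M) ≫ X ◁ MonoidalClosed.curry (A := X) (snd X M) := by
      ext <;> simp [X]
    have h3 : X ◁ MonoidalClosed.curry (A := X) (snd X M) ≫ (ihom.ev X).app M = snd X M :=
      (MonoidalClosed.uncurry_eq (A := X) _).symm.trans (MonoidalClosed.uncurry_curry (A := X) _)
    refine ((Category.assoc _ _ _).trans (congrArg (_ ≫ ·) (Category.assoc _ _ _))).symm.trans ?_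
    refine (congrArg (· ≫ (ihom.ev X).app M) h2).trans ((Category.assoc _ _ _).trans ?_)
    refine (congrArg (_ ≫ ·) h3).trans ?_
    rw [hlift]
    exact lift_snd _ _

/-! ### Identities between actions of scaling homomorphisms -/

section Act

variable {M T : K} {A : CahiersAlg} (α : T ⟶ D.obj (op A))

theorem act_scaleBy_one (v : T ⟶ (prolong D M).obj w1) :
    act D α (scaleBy (1 : A.obj)) v = v := by
  rw [scaleBy_one]
  exact (act_extend D α (𝟙 w1) v).trans ((congrArg (v ≫ ·) ((prolong D M).map_id w1)).trans (Category.comp_id v))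

theorem act_scaleBy_mul (a b : A.obj) (v : T ⟶ (prolong D M).obj w1) :
    act D α (scaleBy (a * b)) v = act D α (scaleBy a) (act D α (scaleBy b) v) := by
  rw [act_act, scaleBy_mul]

theorem act_comp_map {V W U : WeilAlg} (g : weilToCahiers.obj V ⟶ (weilToCahiers.obj W).tensor A)
    (f : W ⟶ U) (v : T ⟶ (prolong D M).obj V) :
    act D α g v ≫ (prolong D M).map f =
      act D α (g ≫ CahiersAlg.desc (extend f A) ((weilToCahiers.obj U).inr A)) v := by
  rw [← act_extend D α, act_act]

theorem act_map_comp {V W U : WeilAlg} (g : weilToCahiers.obj W ⟶ (weilToCahiers.obj U).tensor A)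
    (f : V ⟶ W) (v : T ⟶ (prolong D M).obj V) :
    act D α g (v ≫ (prolong D M).map f) = act D α (weilToCahiers.map f ≫ g) v := by
  rw [← act_extend D α, act_act, Category.assoc, CahiersAlg.inl_desc]

theorem act_scaleBy_aug (a : A.obj) (v : T ⟶ (prolong D M).obj w1) :
    act D α (scaleBy a) v ≫ (prolong D M).map aug1 = v ≫ (prolong D M).map aug1 := by
  rw [act_comp_map, scaleBy_aug, act_extend]

theorem act_scaleBy₂_comp (f : w2 ⟶ w1) (r s : ℝ) (hx : f.hom.hom Alg2.x = r • Alg1.x)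
    (hy : f.hom.hom Alg2.y = s • Alg1.x) (a : A.obj) (u : T ⟶ (prolong D M).obj w2) :
    act D α (scaleBy₂ a) u ≫ (prolong D M).map f =
      act D α (scaleBy a) (u ≫ (prolong D M).map f) := by
  rw [act_comp_map, scaleBy₂_extend f r s hx hy, act_map_comp]

theorem act_combine_comp (f : w2 ⟶ w1) (r s : ℝ) (hx : f.hom.hom Alg2.x = r • Alg1.x)
    (hy : f.hom.hom Alg2.y = s • Alg1.x) (a b : A.obj) (v : T ⟶ (prolong D M).obj w1) :
    act D α (combine a b) v ≫ (prolong D M).map f = act D α (scaleBy (r • a + s • b)) v := by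
  rw [act_comp_map, combine_extend f r s hx hy]

end Act

/-! ### The tangent bundle as a module object -/

section Tangent

variable {M : K}

/-- The morphism of `K` underlying a morphism over `M` to a prolongation. -/
def vec {T : Over M} {W : WeilAlg} {e : W ⟶ wR} (v : T ⟶ prolongOver D M e) :
    T.left ⟶ (prolong D M).obj W := v.left

/-- A morphism over `M` to a prolongation from its underlying morphism. -/
def mkVec {T : Over M} {W : WeilAlg} (e : W ⟶ wR) (u : T.left ⟶ (prolong D M).obj W)
    (h : (u ≫ (prolong D M).map e) ≫ prolongReal D M = T.hom) : T ⟶ prolongOver D M e :=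
  Over.homMk u ((Category.assoc _ _ _).symm.trans h)

/-! ### Points of prolongations over `M` -/

section

variable {T T' : Over M} {V W : WeilAlg} {d : V ⟶ wR} {e : W ⟶ wR}

theorem vec_mkVec (u : T.left ⟶ (prolong D M).obj W)
    (h : (u ≫ (prolong D M).map e) ≫ prolongReal D M = T.hom) : vec (mkVec e u h) = u := rfl

theorem vec_ext {v w : T ⟶ prolongOver D M e} (h : vec v = vec w) : v = w :=
  Over.OverMorphism.ext h

theorem vec_hom (v : T ⟶ prolongOver D M e) :
    (vec v ≫ (prolong D M).map e) ≫ prolongReal D M = T.hom :=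
  (Category.assoc _ _ _).trans (Over.w v)

theorem vec_comp_prolongOverMap (v : T ⟶ prolongOver D M d) (f : V ⟶ W) (h : f ≫ e = d) :
    vec (v ≫ prolongOverMap D M f h) = vec v ≫ (prolong D M).map f := rfl

theorem comp_vec (f : T' ⟶ T) (v : T ⟶ prolongOver D M d) : vec (f ≫ v) = f.left ≫ vec v := rfl

/-- Both sides become the structure map of `T` after the isomorphism `M^{D(ℝ)} ≅ M`. This gives the
compatibility required for lifting to pullbacks of prolongations. -/
theorem vec_comp_aug_eq (v : T ⟶ prolongOver D M d) (w : T ⟶ prolongOver D M e) :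
    vec v ≫ (prolong D M).map d = vec w ≫ (prolong D M).map e := by
  have := isIso_prolongReal D M
  rw [← cancel_mono (prolongReal D M), vec_hom, vec_hom]

end

/-- Two tangent vectors with the same base point form one point of the pullback `M^{D(2)}`. -/
theorem exists_tangent₂ (hM : Microlinear D M) {T : Over M} (x y : T ⟶ tangent D M) :
    ∃ u : T ⟶ prolongOver D M aug2, u ≫ prolongOverMap D M proj1 proj1_aug = x ∧
      u ≫ prolongOverMap D M proj2 proj2_aug = y := by
  have sq := hM.isPullback isPullback_proj_algebra
  have h1 := sq.lift_fst _ _ (vec_comp_aug_eq x y)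
  refine ⟨mkVec aug2 (sq.lift _ _ (vec_comp_aug_eq x y)) ?_, vec_ext ?_, vec_ext ?_⟩
  · rw [← vec_hom x, ← proj1_aug, Functor.map_comp, ← Category.assoc, h1]
  · rw [vec_comp_prolongOverMap, vec_mkVec, h1]
  · rw [vec_comp_prolongOverMap, vec_mkVec, sq.lift_snd]

/-- Pairing the point of `M^{D(2)}` for `x, y` with `z` gives a point of `M^{D(W)}`, where `W` is
the fibre product over ℝ of ℝ[X,Y]/(X²,Y²,XY) and ℝ[X]/(X²). Additive laws can then be checked among
homomorphisms `W ⟶ w1`. -/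
theorem exists_tangent₃ (hM : Microlinear D M) {T : Over M} (x y z : T ⟶ tangent D M) :
    ∃ (W : WeilAlg) (t : T.left ⟶ (prolong D M).obj W) (a b c : W ⟶ w1),
      vec x = t ≫ (prolong D M).map a ∧ vec y = t ≫ (prolong D M).map b ∧
        vec z = t ≫ (prolong D M).map c := by
  obtain ⟨u, rfl, rfl⟩ := exists_tangent₂ hM x y
  obtain ⟨W, p, q, sq⟩ := WeilAlg.exists_isPullback aug2 aug1
  have sq' := hM.isPullback sq
  refine ⟨W, sq'.lift _ _ (vec_comp_aug_eq u z), p ≫ proj1, p ≫ proj2, q, ?_, ?_, ?_⟩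
  · rw [Functor.map_comp, sq'.lift_fst_assoc, vec_comp_prolongOverMap]
  · rw [Functor.map_comp, sq'.lift_fst_assoc, vec_comp_prolongOverMap]
  · rw [sq'.lift_snd]

/-! ### Addition and zero in the slice over `M` -/

variable [HasPullbacks K]

/-- Existence of joint representatives, applied to the universal pair of vectors, gives a right
inverse; uniqueness in the pullback square makes it two-sided. -/
theorem isIso_lift_prolongOverMap (hM : Microlinear D M) :
    IsIso (lift (prolongOverMap D M proj1 proj1_aug) (prolongOverMap D M proj2 proj2_aug)) := by
  have sq := hM.isPullback isPullback_proj_algebra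
  obtain ⟨u, hu, hu'⟩ := exists_tangent₂ hM (fst (tangent D M) (tangent D M)) (snd _ _)
  have h : u ≫ lift (prolongOverMap D M proj1 proj1_aug) (prolongOverMap D M proj2 proj2_aug) =
      𝟙 _ := by
    rw [comp_lift, hu, hu', lift_fst_snd]
  refine ⟨u, vec_ext (sq.hom_ext ?_ ?_), h⟩
  · rw [← vec_comp_prolongOverMap (e := aug1) _ _ proj1_aug, Category.assoc, hu, lift_fst,
      ← vec_comp_prolongOverMap (e := aug1) _ _ proj1_aug, Category.id_comp]
  · rw [← vec_comp_prolongOverMap (e := aug1) _ _ proj2_aug, Category.assoc, hu', lift_snd,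
      ← vec_comp_prolongOverMap (e := aug1) _ _ proj2_aug, Category.id_comp]

/-- The addition of the tangent bundle of a microlinear object. -/
def tangentAdd (hM : Microlinear D M) : tangent D M ⊗ tangent D M ⟶ tangent D M :=
  have := isIso_lift_prolongOverMap hM
  inv (lift (prolongOverMap D M proj1 proj1_aug) (prolongOverMap D M proj2 proj2_aug)) ≫
    prolongOverMap D M fold fold_aug

theorem lift_tangentAdd (hM : Microlinear D M) :
    lift (prolongOverMap D M proj1 proj1_aug) (prolongOverMap D M proj2 proj2_aug) ≫
      tangentAdd hM = prolongOverMap D M fold fold_aug := by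
  have := isIso_lift_prolongOverMap hM
  exact IsIso.hom_inv_id_assoc _ _

/-- Any point of `M^{D(2)}` with the right projections computes the sum, so later arguments need
only exhibit one and never handle the inverse. -/
theorem vec_lift_tangentAdd (hM : Microlinear D M) {T : Over M} (v w : T ⟶ tangent D M)
    (u : T.left ⟶ (prolong D M).obj w2) (hv : u ≫ (prolong D M).map proj1 = vec v)
    (hw : u ≫ (prolong D M).map proj2 = vec w) :
    vec (lift v w ≫ tangentAdd hM) = u ≫ (prolong D M).map fold := by
  let t : T ⟶ prolongOver D M aug2 := mkVec aug2 u (by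
    rw [← proj1_aug, Functor.map_comp, ← Category.assoc, hv, vec_hom])
  have h1 : t ≫ prolongOverMap D M proj1 proj1_aug = v := vec_ext hv
  have h2 : t ≫ prolongOverMap D M proj2 proj2_aug = w := vec_ext hw
  rw [← h1, ← h2, ← comp_lift, Category.assoc, lift_tangentAdd, vec_comp_prolongOverMap, vec_mkVec]

/-- This transports the group structure on homomorphisms `W ⟶ w1` to vectors represented by a common
point `t`. -/
theorem vec_lift_tangentAdd_of_eq_map (hM : Microlinear D M) {T : Over M}
    (v w : T ⟶ tangent D M) {W : WeilAlg} (t : T.left ⟶ (prolong D M).obj W) (a b : W ⟶ w1)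
    (hv : vec v = t ≫ (prolong D M).map a) (hw : vec w = t ≫ (prolong D M).map b) :
    vec (lift v w ≫ tangentAdd hM) = t ≫ (prolong D M).map (addHom a b) := by
  have h := WeilAlg.hom_wR_ext (a ≫ aug1) (b ≫ aug1)
  rw [vec_lift_tangentAdd hM v w (t ≫ (prolong D M).map (isPullback_proj.lift a b h))]
  · rw [Category.assoc, ← Functor.map_comp]
    rfl
  · rw [Category.assoc, ← Functor.map_comp, isPullback_proj.lift_fst, hv]
  · rw [Category.assoc, ← Functor.map_comp, isPullback_proj.lift_snd, hw]

variable (D M) in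
/-- The zero section of the tangent bundle. -/
def tangentZero : 𝟙_ (Over M) ⟶ tangent D M :=
  have := isIso_prolongReal D M
  mkVec aug1 (inv (prolongReal D M) ≫ (prolong D M).map unit1) (by
    have h : unit1 ≫ aug1 = 𝟙 wR := WeilAlg.hom_wR_ext _ _
    rw [Category.assoc, Category.assoc, ← Functor.map_comp_assoc, h, CategoryTheory.Functor.map_id,
      Category.id_comp, IsIso.inv_hom_id]
    rfl)

/-- The zero vector at the base point of `v` is constant, hence comes from `t` through `W ⟶ ℝ ⟶
ℝ[X]/(X²)`. -/
theorem vec_toUnit_tangentZero {T : Over M} (v : T ⟶ tangent D M) {W : WeilAlg}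
    (t : T.left ⟶ (prolong D M).obj W) (a : W ⟶ w1) (hv : vec v = t ≫ (prolong D M).map a) :
    vec (toUnit T ≫ tangentZero D M) = t ≫ (prolong D M).map ((a ≫ aug1) ≫ unit1) := by
  have := isIso_prolongReal D M
  have h : T.hom = (t ≫ (prolong D M).map (a ≫ aug1)) ≫ prolongReal D M := by
    rw [Functor.map_comp, ← Category.assoc t, ← hv, vec_hom]
  change T.hom ≫ inv (prolongReal D M) ≫ (prolong D M).map unit1 = _
  rw [h, Category.assoc, IsIso.hom_inv_id_assoc, Category.assoc, ← Functor.map_comp]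

theorem neg1_aug : neg1 ≫ aug1 = aug1 := WeilAlg.hom_wR_ext _ _

/-! ### Additive laws of the tangent bundle -/

section

variable (hM : Microlinear D M) {T : Over M} (x y z : T ⟶ tangent D M)

theorem tangent_zero_add :
    lift x (toUnit T ≫ tangentZero D M) ≫ tangentAdd hM = x := by
  refine vec_ext ?_
  -- A single vector represents itself: `W` is ℝ[X]/(X²) and the homomorphism is the identity.
  have hx : vec x = vec x ≫ (prolong D M).map (𝟙 w1) := by
    rw [CategoryTheory.Functor.map_id, Category.comp_id]
  rw [vec_lift_tangentAdd_of_eq_map hM _ _ (vec x) _ _ hx (vec_toUnit_tangentZero x _ _ hx),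
    addHom_unit, ← hx]

theorem tangent_add_neg :
    lift x (x ≫ prolongOverMap D M neg1 neg1_aug) ≫ tangentAdd hM =
      toUnit T ≫ tangentZero D M := by
  refine vec_ext ?_
  have hx : vec x = vec x ≫ (prolong D M).map (𝟙 w1) := by
    rw [CategoryTheory.Functor.map_id, Category.comp_id]
  have hn : vec (x ≫ prolongOverMap D M neg1 neg1_aug) =
      vec x ≫ (prolong D M).map (𝟙 w1 ≫ neg1) := by
    rw [Category.id_comp, vec_comp_prolongOverMap]
  rw [vec_lift_tangentAdd_of_eq_map hM _ _ (vec x) _ _ hx hn,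
    addHom_neg _ (𝟙 w1 ≫ aug1), vec_toUnit_tangentZero x _ _ hx]

theorem tangent_add_comm : lift x y ≫ tangentAdd hM = lift y x ≫ tangentAdd hM := by
  refine vec_ext ?_
  obtain ⟨W, t, a, b, -, ha, hb, -⟩ := exists_tangent₃ hM x y x
  rw [vec_lift_tangentAdd_of_eq_map hM _ _ t a b ha hb,
    vec_lift_tangentAdd_of_eq_map hM _ _ t b a hb ha, addHom_comm]

theorem tangent_add_assoc :
    lift (lift x y ≫ tangentAdd hM) z ≫ tangentAdd hM =
      lift x (lift y z ≫ tangentAdd hM) ≫ tangentAdd hM := by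
  refine vec_ext ?_
  obtain ⟨W, t, a, b, c, ha, hb, hc⟩ := exists_tangent₃ hM x y z
  rw [vec_lift_tangentAdd_of_eq_map hM _ _ t _ c
      (vec_lift_tangentAdd_of_eq_map hM _ _ t a b ha hb) hc,
    vec_lift_tangentAdd_of_eq_map hM _ _ t a _ ha
      (vec_lift_tangentAdd_of_eq_map hM _ _ t b c hb hc), addHom_assoc]

end

variable (D M) in
/-- The scalar multiplication of the tangent bundle. -/
def tangentSMul : lineOver D M ⊗ tangent D M ⟶ tangent D M :=
  mkVec aug1 (lift ((fst (lineOver D M) (tangent D M)).left ≫ fst (line D) M)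
    (vec (snd (lineOver D M) (tangent D M))) ≫ scalar D M) (by
      obtain ⟨A, α, a, ha⟩ := exists_elt₁ D
        ((fst (lineOver D M) (tangent D M)).left ≫ fst (line D) M)
      rw [ha, lift_scalar, act_scaleBy_aug, vec_hom])

theorem vec_lift_tangentSMul {T : Over M} (r : T ⟶ lineOver D M) (v : T ⟶ tangent D M)
    {A : CahiersAlg} {α : T.left ⟶ D.obj (op A)} {a : A.obj}
    (h : r.left ≫ fst (line D) M = elt D α a) :
    vec (lift r v ≫ tangentSMul D M) = act D α (scaleBy a) (vec v) := by
  rw [comp_vec, tangentSMul, vec_mkVec, comp_lift_assoc, ← Category.assoc, lift_left_fst_left,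
    ← comp_vec, lift_snd, h, lift_scalar]

/-! ### Module laws involving scalars -/

section

variable {T : Over M} (r s : T ⟶ lineOver D M) (v w : T ⟶ tangent D M)

theorem tangent_one_smul : lift (toUnit T ≫ fiberwiseOne D M) v ≫ tangentSMul D M = v := by
  refine vec_ext ?_
  -- Only some `α : T ⟶ D(A)` is needed, since the unity is `1` in every `A`.
  obtain ⟨A, α, -⟩ := exists_elt₁ D (toUnit T.left ≫ lineOne D)
  have h : (toUnit T ≫ fiberwiseOne D M).left ≫ fst (line D) M = elt D α (1 : A.obj) :=
    (toUnit_fiberwiseConst_left_fst D T _).trans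
      ((toUnit_lineConst D α 1).trans (by rw [map_one]))
  rw [vec_lift_tangentSMul _ v h]
  exact act_scaleBy_one α _

theorem tangent_mul_smul :
    lift (lift r s ≫ fiberwise D M (lineMul D)) v ≫ tangentSMul D M =
      lift r (lift s v ≫ tangentSMul D M) ≫ tangentSMul D M := by
  refine vec_ext ?_
  obtain ⟨A, α, a, b, ha, hb⟩ := exists_elt₂ D (r.left ≫ fst (line D) M) (s.left ≫ fst (line D) M)
  have h : (lift r s ≫ fiberwise D M (lineMul D)).left ≫ fst (line D) M = elt D α (a * b) := by
    rw [lift_fiberwise_left_fst, ha, hb, lift_lineMul]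
  rw [vec_lift_tangentSMul _ v h, vec_lift_tangentSMul r _ ha, vec_lift_tangentSMul s v hb]
  exact act_scaleBy_mul α a b _

/-- Represent `v, w` by one point `u` of `M^{D(2)}`. Scaling `X` and `Y` of `u` simultaneously
commutes with both projections and with `fold`, so the scaled point represents `rv, rw` and folds to
`r(v + w)`. -/
theorem tangent_smul_add (hM : Microlinear D M) :
    lift r (lift v w ≫ tangentAdd hM) ≫ tangentSMul D M =
      lift (lift r v ≫ tangentSMul D M) (lift r w ≫ tangentSMul D M) ≫ tangentAdd hM := by
  refine vec_ext ?_
  obtain ⟨A, α, a, ha⟩ := exists_elt₁ D (r.left ≫ fst (line D) M)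
  obtain ⟨u, rfl, rfl⟩ := exists_tangent₂ hM v w
  rw [vec_lift_tangentSMul r _ ha, vec_lift_tangentAdd hM _ _ (vec u) rfl rfl,
    vec_lift_tangentAdd hM _ _ (act D α (scaleBy₂ a) (vec u))]
  · exact (act_scaleBy₂_comp α fold 1 1 (by rw [fold_x, one_smul]) (by rw [fold_y, one_smul])
      a (vec u)).symm
  · rw [vec_lift_tangentSMul r _ ha, vec_comp_prolongOverMap]
    exact act_scaleBy₂_comp α proj1 1 0 (by rw [proj1_x, one_smul]) (by rw [proj1_y, zero_smul])
      a (vec u)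
  · rw [vec_lift_tangentSMul r _ ha, vec_comp_prolongOverMap]
    exact act_scaleBy₂_comp α proj2 0 1 (by rw [proj2_x, zero_smul]) (by rw [proj2_y, one_smul])
      a (vec u)

/-- The homomorphism `X ↦ aX + bY` turns `v` into a point of `M^{D(2)}` with projections `rv` and
`sv`; setting `Y = X` leaves the scaling by `a + b`. -/
theorem tangent_add_smul (hM : Microlinear D M) :
    lift (lift r s ≫ fiberwise D M (lineAdd D)) v ≫ tangentSMul D M =
      lift (lift r v ≫ tangentSMul D M) (lift s v ≫ tangentSMul D M) ≫ tangentAdd hM := by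
  refine vec_ext ?_
  obtain ⟨A, α, a, b, ha, hb⟩ := exists_elt₂ D (r.left ≫ fst (line D) M) (s.left ≫ fst (line D) M)
  have h : (lift r s ≫ fiberwise D M (lineAdd D)).left ≫ fst (line D) M = elt D α (a + b) := by
    rw [lift_fiberwise_left_fst, ha, hb, lift_lineAdd]
  rw [vec_lift_tangentSMul _ v h, vec_lift_tangentAdd hM _ _ (act D α (combine a b) (vec v))]
  · refine ((act_combine_comp α fold 1 1 (by rw [fold_x, one_smul]) (by rw [fold_y, one_smul])
      a b (vec v)).trans ?_).symm
    rw [one_smul, one_smul]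
  · rw [vec_lift_tangentSMul r _ ha]
    refine (act_combine_comp α proj1 1 0 (by rw [proj1_x, one_smul]) (by rw [proj1_y, zero_smul])
      a b (vec v)).trans ?_
    rw [one_smul, zero_smul, add_zero]
  · rw [vec_lift_tangentSMul s _ hb]
    refine (act_combine_comp α proj2 0 1 (by rw [proj2_x, zero_smul]) (by rw [proj2_y, one_smul])
      a b (vec v)).trans ?_
    rw [one_smul, zero_smul, zero_add]

end

/-- The tangent bundle of a microlinear object is a module object over `ℝ × M ⟶ M`. -/
abbrev tangentRingModObj (hM : Microlinear D M) :
    letI := lineOverCommRingObj D M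
    RingModObj (lineOver D M) (tangent D M) :=
  letI := lineOverCommRingObj D M
  { zero := tangentZero D M
    add := tangentAdd hM
    neg := prolongOverMap D M neg1 neg1_aug
    smul := tangentSMul D M
    zero_add := whiskerRight_comp_of_points fun _ =>
      (tangent_add_comm hM _ _).trans (tangent_zero_add hM _)
    add_zero := whiskerLeft_comp_of_points fun _ => tangent_zero_add hM _
    add_assoc := assoc_of_points fun _ _ _ => tangent_add_assoc hM _ _ _
    left_neg := (tangent_add_comm hM _ _).trans
      ((congrArg (lift (𝟙 _) · ≫ _) (Category.id_comp _).symm).trans (tangent_add_neg hM (𝟙 _)))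
    right_neg :=
      (congrArg (lift (𝟙 _) · ≫ _) (Category.id_comp _).symm).trans (tangent_add_neg hM (𝟙 _))
    add_comm := braiding_comp_of_points fun _ _ => tangent_add_comm hM _ _
    one_smul := whiskerRight_comp_of_points fun _ => tangent_one_smul _
    mul_smul := assoc_of_points fun _ _ _ => tangent_mul_smul _ _ _
    smul_add := smul_add_of_points fun _ _ _ => tangent_smul_add _ _ _ hM
    add_smul := add_smul_of_points fun _ _ _ => tangent_add_smul _ _ _ hM }

end Tangent

end WeilCat

end

/-! ### Assembly of the theorem -/

theorem theorem5p1 {K : Type u} [Category.{v} K] [CartesianMonoidalCategory K] [HasFiniteLimits K]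
    [MonoidalClosed K] [HasSubobjectClassifier K]
    (D : CahiersAlgᵒᵖ ⥤ K) [PreservesFiniteProducts D] (M : K) (hM : Microlinear D M) :
    -- the square of Weil algebras is a pullback, of Weil algebras and of commutative algebras
    IsPullback proj1 proj2 aug1 aug1 ∧
    IsPullback (IsWeilAlg.ι.map proj1) (IsWeilAlg.ι.map proj2)
      (IsWeilAlg.ι.map aug1) (IsWeilAlg.ι.map aug1) ∧
    -- the induced square with corner `M^{D(2)}` is a pullback, whose base is `M^{D(ℝ)} = M`
    IsPullback ((prolong D M).map proj1) ((prolong D M).map proj2)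
      ((prolong D M).map aug1) ((prolong D M).map aug1) ∧
    IsIso (prolongReal D M) ∧
    -- in the slice over `M`: the comparison of `M^{D(2)}` with `M^D ×_M M^D` is invertible
    IsIso (lift (prolongOverMap D M proj1 proj1_aug) (prolongOverMap D M proj2 proj2_aug)) ∧
    -- `ℝ × M ⟶ M` is a commutative ring object with the operations of `ℝ`
    ∃ _ : CommRingObj (lineOver D M),
      σ[lineOver D M] = fiberwise D M (lineAdd D) ∧
      μ[lineOver D M] = fiberwise D M (lineMul D) ∧
      η[lineOver D M] = fiberwiseOne D M ∧
      -- and `M^D ⟶ M` is a module object over it, with the following addition and action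
      ∃ _ : RingModObj (lineOver D M) (tangent D M),
        lift (prolongOverMap D M proj1 proj1_aug) (prolongOverMap D M proj2 proj2_aug) ≫
          σ[tangent D M] = prolongOverMap D M fold fold_aug ∧
        γ[lineOver D M, tangent D M].left =
          lift ((fst (lineOver D M) (tangent D M)).left ≫ fst (line D) M)
            (snd (lineOver D M) (tangent D M)).left ≫ scalar D M := by
  refine ⟨isPullback_proj, isPullback_proj_algebra, hM.isPullback isPullback_proj_algebra,
    isIso_prolongReal D M, isIso_lift_prolongOverMap hM, lineOverCommRingObj D M, rfl, rfl, rfl,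
    tangentRingModObj hM, lift_tangentAdd hM, rfl⟩
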